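/- Let $A$ be a complex $^*$-algebra, not necessarily unital, with non-degenerate product, and let $M(A)$ and $M(A\otimes A)$ denote the multiplier algebras. Let $\Delta: A\to M(A\otimes A)$ make $A$ into a multiplier Hopf $^*$-algebra. That is, $\Delta$ is a coassociative $^*$-homomorphism such that $\Delta(a)(1\otimes b)$ and $(a\otimes 1)\Delta(b)$ belong to $A\otimes A$ for all $a,b\in A$, and such that the linear maps $a\otimes b\mapsto\Delta(a)(1\otimes b)$ and $a\otimes b\mapsto(a\otimes 1)\Delta(b)$ are bijections of $A\otimes A$ onto itself. Coassociativity means that $$(a\otimes 1\otimes 1)(\Delta\otimes\iota)(\Delta(b)(1\otimes c))=(\iota\otimes\Delta)((a\otimes 1)\Delta(b))(1\otimes 1\otimes c)\qquad\text{for all }a,b,c\in A.$$ A linear functional $\omega$ on $A$ is called positive if $\omega(a^*a)\ge 0$ for all $a\in A$. A left integral is a non-zero linear functional $\varphi$ on $A$ with $(\iota\otimes\varphi)\Delta(a)=\varphi(a)1$ in $M(A)$ for all $a$. A right integral is a non-zero linear functional $\psi$ on $A$ with $(\psi\otimes\iota)\Delta(a)=\psi(a)1$ in $M(A)$ for all $a$.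 An antipode is a linear map $S:A\to A$ for which there is a linear functional $\varepsilon$ on $A$ (the counit) such that for all $a,b\in A$, with $m$ the multiplication map, $$(\varepsilon\otimes\iota)(\Delta(a)(1\otimes b))=ab,\qquad (\iota\otimes\varepsilon)((a\otimes 1)\Delta(b))=ab,$$ $$m(S\otimes\iota)(\Delta(a)(1\otimes b))=\varepsilon(a)b,\qquad m(\iota\otimes S)((a\otimes 1)\Delta(b))=\varepsilon(b)a.$$ Theorem. Let $(A,\Delta)$ be a multiplier Hopf $^*$-algebra with a positive left integral $\varphi$. Then $A$ has a unique antipode $S$, and $\varphi\circ S$ is a positive right integral. -/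

import Mathlib

open scoped TensorProduct ComplexOrder

noncomputable section

/-! ### The multiplier algebra of an algebra over the complex numbers -/

section Multiplier

variable (R : Type*) [NonUnitalRing R] [Module ℂ R] [IsScalarTower ℂ R R] [SMulCommClass ℂ R R]

/-- The multiplier algebra `M(R)`: pairs `(L, Λ)` of linear maps on `R`, thought of as
`L x = m x` and `Λ x = x m`, with `(x m) y = x (m y)`. The second component lives in the opposite
of the endomorphism algebra, so that the product is
`(L₁, Λ₁) (L₂, Λ₂) = (L₁ ∘ L₂, Λ₂ ∘ Λ₁)`. -/
def multiplierSubalgebra : Subalgebra ℂ (Module.End ℂ R × (Module.End ℂ R)ᵐᵒᵖ) where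
  carrier := {p | ∀ x y : R, p.2.unop x * y = x * p.1 y}
  mul_mem' := by
    intro p q hp hq x y
    simp only [Set.mem_ofPred_eq] at hp hq
    simp [hp, hq]
  add_mem' := by
    intro p q hp hq x y
    simp only [Set.mem_ofPred_eq] at hp hq
    simp [hp, hq, add_mul, mul_add]
  algebraMap_mem' := by
    intro c x y
    simp [Module.algebraMap_end_apply, smul_mul_assoc, mul_smul_comm]

/-- The multiplier algebra `M(R)`, a unital algebra over `ℂ`. -/
abbrev MultiplierAlg : Type _ := multiplierSubalgebra R

variable {R}

namespace MultiplierAlg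

/-- The left action `x ↦ m x` of a multiplier `m`. -/
def left (m : MultiplierAlg R) : R →ₗ[ℂ] R := m.1.1

/-- The right action `x ↦ x m` of a multiplier `m`. -/
def right (m : MultiplierAlg R) : R →ₗ[ℂ] R := m.1.2.unop

/-- The multiplier with given left and right actions. -/
def mk (L Λ : R →ₗ[ℂ] R) (h : ∀ x y, Λ x * y = x * L y) : MultiplierAlg R :=
  ⟨(L, MulOpposite.op Λ), h⟩

theorem right_mul_eq (m : MultiplierAlg R) (x y : R) : m.right x * y = x * m.left y :=
  m.2 x y

@[ext]
theorem ext {m n : MultiplierAlg R} (h₁ : ∀ x, m.left x = n.left x)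
    (h₂ : ∀ x, m.right x = n.right x) : m = n :=
  Subtype.ext (Prod.ext (LinearMap.ext h₁) (MulOpposite.unop_injective (LinearMap.ext h₂)))

@[simp] theorem left_mk (L Λ : R →ₗ[ℂ] R) (h : ∀ x y, Λ x * y = x * L y) (x : R) :
    (mk L Λ h).left x = L x := rfl

@[simp] theorem right_mk (L Λ : R →ₗ[ℂ] R) (h : ∀ x y, Λ x * y = x * L y) (x : R) :
    (mk L Λ h).right x = Λ x := rfl

@[simp] theorem left_mul (m n : MultiplierAlg R) (x : R) :
    (m * n).left x = m.left (n.left x) := rfl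

@[simp] theorem right_mul (m n : MultiplierAlg R) (x : R) :
    (m * n).right x = n.right (m.right x) := rfl

@[simp] theorem left_smul (c : ℂ) (m : MultiplierAlg R) (x : R) :
    (c • m).left x = c • m.left x := rfl

@[simp] theorem right_smul (c : ℂ) (m : MultiplierAlg R) (x : R) :
    (c • m).right x = c • m.right x := rfl

@[simp] theorem left_zero (x : R) : (0 : MultiplierAlg R).left x = 0 := rfl

@[simp] theorem right_zero (x : R) : (0 : MultiplierAlg R).right x = 0 := rfl

@[simp] theorem left_add (m n : MultiplierAlg R) (x : R) :
    (m + n).left x = m.left x + n.left x := rfl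

@[simp] theorem right_add (m n : MultiplierAlg R) (x : R) :
    (m + n).right x = m.right x + n.right x := rfl

/-- The canonical map of `R` to `M(R)`: the element `a` acts by left and right multiplication. -/
def ofElem (a : R) : MultiplierAlg R :=
  mk (LinearMap.mulLeft ℂ a) (LinearMap.mulRight ℂ a) fun x y => by
    simp [mul_assoc]

@[simp] theorem left_ofElem (a x : R) : (ofElem a).left x = a * x := rfl

@[simp] theorem right_ofElem (a x : R) : (ofElem a).right x = x * a := rfl

section Star

variable [StarRing R] [StarModule ℂ R]

/-- The map `x ↦ (f (x*))*` for a linear map `f`. -/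
def conjMap (f : R →ₗ[ℂ] R) : R →ₗ[ℂ] R where
  toFun x := star (f (star x))
  map_add' x y := by simp
  map_smul' c x := by simp

/-- The adjoint of a multiplier: `m* x = (x* m)*` and `x m* = (m x*)*`. -/
instance : StarRing (MultiplierAlg R) where
  star m := mk (conjMap m.right) (conjMap m.left) fun x y => by
    change star (m.left (star x)) * y = x * star (m.right (star y))
    apply star_injective
    simp [right_mul_eq]
  star_involutive m := by
    ext x
    · change star (star (m.left (star (star x)))) = m.left x
      simp
    · change star (star (m.right (star (star x)))) = m.right x
      simp
  star_mul m n := by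
    ext x
    · change star (n.right (m.right (star x))) =
        star (n.right (star (star (m.right (star x)))))
      simp
    · change star (m.left (n.left (star x))) =
        star (m.left (star (star (n.left (star x)))))
      simp
  star_add m n := by
    ext x
    · change star (m.right (star x) + n.right (star x)) =
        star (m.right (star x)) + star (n.right (star x))
      simp
    · change star (m.left (star x) + n.left (star x)) =
        star (m.left (star x)) + star (n.left (star x))
      simp

theorem star_left (m : MultiplierAlg R) (x : R) : (star m).left x = star (m.right (star x)) := rfl

theorem star_right (m : MultiplierAlg R) (x : R) : (star m).right x = star (m.left (star x)) := rfl

theorem star_ofElem (a : R) : star (ofElem a) = ofElem (star a) := by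
  ext x
  · change star (star x * a) = star a * x
    simp
  · change star (a * star x) = x * star a
    simp

end Star

end MultiplierAlg

end Multiplier

/-! ### Multiplier Hopf *-algebras -/

section MultiplierHopf

variable {A : Type*} [NonUnitalRing A] [Module ℂ A] [IsScalarTower ℂ A A] [SMulCommClass ℂ A A]

/-- The multiplier `a ⊗ 1` of `A ⊗ A`. -/
def tmulOne (a : A) : MultiplierAlg (A ⊗[ℂ] A) :=
  MultiplierAlg.mk (TensorProduct.map (LinearMap.mulLeft ℂ a) LinearMap.id)
    (TensorProduct.map (LinearMap.mulRight ℂ a) LinearMap.id) fun x y => by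
      induction x with
      | zero => simp
      | add x x' hx hx' => simp only [map_add, add_mul, hx, hx']
      | tmul x x' =>
        induction y with
        | zero => simp
        | add y y' hy hy' => simp only [map_add, mul_add, hy, hy']
        | tmul y y' => simp [Algebra.TensorProduct.tmul_mul_tmul, mul_assoc]

/-- The multiplier `1 ⊗ a` of `A ⊗ A`. -/
def oneTmul (a : A) : MultiplierAlg (A ⊗[ℂ] A) :=
  MultiplierAlg.mk (TensorProduct.map LinearMap.id (LinearMap.mulLeft ℂ a))
    (TensorProduct.map LinearMap.id (LinearMap.mulRight ℂ a)) fun x y => by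
      induction x with
      | zero => simp
      | add x x' hx hx' => simp only [map_add, add_mul, hx, hx']
      | tmul x x' =>
        induction y with
        | zero => simp
        | add y y' hy hy' => simp only [map_add, mul_add, hy, hy']
        | tmul y y' => simp [Algebra.TensorProduct.tmul_mul_tmul, mul_assoc]

@[simp] theorem left_tmulOne (a x y : A) :
    (tmulOne a).left (x ⊗ₜ[ℂ] y) = (a * x) ⊗ₜ[ℂ] y := rfl

@[simp] theorem right_tmulOne (a x y : A) :
    (tmulOne a).right (x ⊗ₜ[ℂ] y) = (x * a) ⊗ₜ[ℂ] y := rfl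

@[simp] theorem left_oneTmul (a x y : A) :
    (oneTmul a).left (x ⊗ₜ[ℂ] y) = x ⊗ₜ[ℂ] (a * y) := rfl

@[simp] theorem right_oneTmul (a x y : A) :
    (oneTmul a).right (x ⊗ₜ[ℂ] y) = x ⊗ₜ[ℂ] (y * a) := rfl

variable [StarRing A] [StarModule ℂ A]

theorem star_tmulOne (a : A) : star (tmulOne a) = tmulOne (star a) := by
  ext x
  · rw [MultiplierAlg.star_left]
    induction x with
    | zero => simp
    | add x y hx hy => simp only [star_add, map_add, hx, hy]
    | tmul x y => simp
  · rw [MultiplierAlg.star_right]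
    induction x with
    | zero => simp
    | add x y hx hy => simp only [star_add, map_add, hx, hy]
    | tmul x y => simp

theorem star_oneTmul (a : A) : star (oneTmul a) = oneTmul (star a) := by
  ext x
  · rw [MultiplierAlg.star_left]
    induction x with
    | zero => simp
    | add x y hx hy => simp only [star_add, map_add, hx, hy]
    | tmul x y => simp
  · rw [MultiplierAlg.star_right]
    induction x with
    | zero => simp
    | add x y hx hy => simp only [star_add, map_add, hx, hy]
    | tmul x y => simp

variable (A) in
/-- A multiplier Hopf *-algebra structure on a (not necessarily unital) complex *-algebra `A` with
non-degenerate product: a coproduct, i.e. a coassociative *-homomorphism `Δ : A → M(A ⊗ A)` for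
which all `Δ(a)(1 ⊗ b)` and `(a ⊗ 1)Δ(b)` lie in `A ⊗ A`, such that the canonical maps
`T₁ : a ⊗ b ↦ Δ(a)(1 ⊗ b)` and `T₂ : a ⊗ b ↦ (a ⊗ 1)Δ(b)` are bijections of `A ⊗ A`.
(The maps `T₁` and `T₂` are determined by `Δ`, since `A ⊗ A` embeds in `M(A ⊗ A)`.) -/
structure MultiplierHopfStarAlgebra where
  /-- The product is non-degenerate. -/
  eq_zero_of_mul_right : ∀ a : A, (∀ b, a * b = 0) → a = 0
  /-- The product is non-degenerate. -/
  eq_zero_of_mul_left : ∀ a : A, (∀ b, b * a = 0) → a = 0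
  /-- The coproduct. -/
  comul : A →⋆ₙₐ[ℂ] MultiplierAlg (A ⊗[ℂ] A)
  /-- The bijection `a ⊗ b ↦ Δ(a)(1 ⊗ b)`. -/
  T₁ : (A ⊗[ℂ] A) ≃ₗ[ℂ] (A ⊗[ℂ] A)
  /-- The bijection `a ⊗ b ↦ (a ⊗ 1)Δ(b)`. -/
  T₂ : (A ⊗[ℂ] A) ≃ₗ[ℂ] (A ⊗[ℂ] A)
  ofElem_T₁ : ∀ a b : A, MultiplierAlg.ofElem (T₁ (a ⊗ₜ[ℂ] b)) = comul a * oneTmul b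
  ofElem_T₂ : ∀ a b : A, MultiplierAlg.ofElem (T₂ (a ⊗ₜ[ℂ] b)) = tmulOne a * comul b
  /-- Coassociativity:
  `(a ⊗ 1 ⊗ 1) (Δ ⊗ ι)(Δ(b)(1 ⊗ c)) = (ι ⊗ Δ)((a ⊗ 1)Δ(b)) (1 ⊗ 1 ⊗ c)`, where
  `(a ⊗ 1 ⊗ 1) (Δ ⊗ ι)(p ⊗ q) = T₂(a ⊗ p) ⊗ q` and
  `(ι ⊗ Δ)(p ⊗ q) (1 ⊗ 1 ⊗ c) = p ⊗ T₁(q ⊗ c)`. -/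
  coassoc : ∀ a b c : A,
    TensorProduct.assoc ℂ A A A
        (T₂.toLinearMap.rTensor A
          ((TensorProduct.assoc ℂ A A A).symm (a ⊗ₜ[ℂ] T₁ (b ⊗ₜ[ℂ] c)))) =
      T₁.toLinearMap.lTensor A
        (TensorProduct.assoc ℂ A A A (T₂ (a ⊗ₜ[ℂ] b) ⊗ₜ[ℂ] c))

namespace MultiplierHopfStarAlgebra

variable (H : MultiplierHopfStarAlgebra A)

/-- The element `Δ(a)(b ⊗ 1)` of `A ⊗ A`, as the adjoint of `(b* ⊗ 1)Δ(a*)`. -/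
def comulMulTmulOne (a b : A) : A ⊗[ℂ] A := star (H.T₂ (star b ⊗ₜ[ℂ] star a))

theorem ofElem_comulMulTmulOne (a b : A) :
    MultiplierAlg.ofElem (H.comulMulTmulOne a b) = H.comul a * tmulOne b := by
  rw [comulMulTmulOne, ← MultiplierAlg.star_ofElem, H.ofElem_T₂, star_mul, star_tmulOne,
    ← map_star, star_star, star_star]

/-- The element `(1 ⊗ b)Δ(a)` of `A ⊗ A`, as the adjoint of `Δ(a*)(1 ⊗ b*)`. -/
def oneTmulMulComul (b a : A) : A ⊗[ℂ] A := star (H.T₁ (star a ⊗ₜ[ℂ] star b))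

theorem ofElem_oneTmulMulComul (b a : A) :
    MultiplierAlg.ofElem (H.oneTmulMulComul b a) = oneTmul b * H.comul a := by
  rw [oneTmulMulComul, ← MultiplierAlg.star_ofElem, H.ofElem_T₁, star_mul, star_oneTmul,
    ← map_star, star_star, star_star]

/-- The slice map `ω ⊗ ι : A ⊗ A → A`. -/
def sliceLeft (ω : A →ₗ[ℂ] ℂ) : A ⊗[ℂ] A →ₗ[ℂ] A :=
  (TensorProduct.lid ℂ A).toLinearMap ∘ₗ ω.rTensor A

/-- The slice map `ι ⊗ ω : A ⊗ A → A`. -/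
def sliceRight (ω : A →ₗ[ℂ] ℂ) : A ⊗[ℂ] A →ₗ[ℂ] A :=
  (TensorProduct.rid ℂ A).toLinearMap ∘ₗ ω.lTensor A

/-- A left integral: a nonzero linear functional `φ` with `(ι ⊗ φ)Δ(a) = φ(a)1` in `M(A)` for all
`a`, where the multiplier `(ι ⊗ φ)Δ(a)` is given by `b ↦ (ι ⊗ φ)(Δ(a)(b ⊗ 1))` and
`b ↦ (ι ⊗ φ)((b ⊗ 1)Δ(a))`. -/
def IsLeftIntegral (φ : A →ₗ[ℂ] ℂ) : Prop :=
  φ ≠ 0 ∧ ∀ a b : A, sliceRight φ (H.comulMulTmulOne a b) = φ a • b ∧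
    sliceRight φ (H.T₂ (b ⊗ₜ[ℂ] a)) = φ a • b

/-- A right integral: a nonzero linear functional `ψ` with `(ψ ⊗ ι)Δ(a) = ψ(a)1` in `M(A)` for all
`a`, where the multiplier `(ψ ⊗ ι)Δ(a)` is given by `b ↦ (ψ ⊗ ι)(Δ(a)(1 ⊗ b))` and
`b ↦ (ψ ⊗ ι)((1 ⊗ b)Δ(a))`. -/
def IsRightIntegral (ψ : A →ₗ[ℂ] ℂ) : Prop :=
  ψ ≠ 0 ∧ ∀ a b : A, sliceLeft ψ (H.T₁ (a ⊗ₜ[ℂ] b)) = ψ a • b ∧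
    sliceLeft ψ (H.oneTmulMulComul b a) = ψ a • b

/-- The counit: `(ε ⊗ ι)(Δ(a)(1 ⊗ b)) = a b` and `(ι ⊗ ε)((a ⊗ 1)Δ(b)) = a b`. -/
def IsCounit (ε : A →ₗ[ℂ] ℂ) : Prop :=
  ∀ a b : A, sliceLeft ε (H.T₁ (a ⊗ₜ[ℂ] b)) = a * b ∧ sliceRight ε (H.T₂ (a ⊗ₜ[ℂ] b)) = a * b

/-- The antipode: with `m` the multiplication and `ε` the counit,
`m (S ⊗ ι)(Δ(a)(1 ⊗ b)) = ε(a) b` and `m (ι ⊗ S)((a ⊗ 1)Δ(b)) = ε(b) a`. -/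
def IsAntipode (S : A →ₗ[ℂ] A) : Prop :=
  ∃ ε : A →ₗ[ℂ] ℂ, H.IsCounit ε ∧ ∀ a b : A,
    LinearMap.mul' ℂ A (S.rTensor A (H.T₁ (a ⊗ₜ[ℂ] b))) = ε a • b ∧
    LinearMap.mul' ℂ A (S.lTensor A (H.T₂ (a ⊗ₜ[ℂ] b))) = ε b • a

end MultiplierHopfStarAlgebra

/-- A linear functional `ω` is positive if `ω(a* a) ≥ 0` for all `a`. -/
def IsPositiveFunctional (ω : A →ₗ[ℂ] ℂ) : Prop := ∀ a : A, 0 ≤ ω (star a * a)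

end MultiplierHopf

end

/-! Left invariance of φ yields the formula S((ι⊗φ)(Δ(p)(1⊗q))) = (ι⊗φ)((1⊗p)Δ(q)). As φ ≠ 0 and
`T₁` is onto, the arguments of S here span A, so the formula can define S. It is consistent because
S(x)e = (ε⊗ι)T₁⁻¹(x⊗e) is forced, which also gives uniqueness. The counit ε comes from
coassociativity alone. The same formula makes φ∘S right invariant.

Positivity is the hard part. The right invariant φ∘S makes left invariant functionals unique up to a
scalar (`IsLeftInvariant.exists_eq_smul`), and φ is faithful (`IsAntipode.faithful`). Uniqueness
applied to slices gives the modular element δ, a multiplier with (φ⊗ι)Δ(a) = φ(a)δ. It is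
selfadjoint, group-like and invertible, and φ(S(x)) = φ(xδ). Below, `L` is left multiplication by δ
and `conjMap L` is right multiplication. What remains is φ(b*bδ) ≥ 0.

A square root of δ is replaced by diagonalization. Slicing Δ(xx*)(1⊗w) by φ(δⁿ·δⁿ) gives nonzero
multiples of δ^(1-2n)w, all in one finite-dimensional space. So every w lies in a finite-dimensional
δ-stable space, where δ is symmetric for φ(x*y), and positive because φ⊗φ is positive. Hence every
element is a sum of eigenvectors with eigenvalues r ≥ 0. Uniqueness gives φ(δx) = cφ(xδ), and an
eigenvector forces c = 1. So φ(e_i e_j*) = 0 unless r_i = r_j, and for b* = ∑ e_i one finds φ(b*bδ)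
= φ(yy*) with y = ∑ √r_i e_i. -/

noncomputable section

set_option linter.unusedSectionVars false

namespace MultiplierHopfStarAlgebra

/-! ### Slice maps and elementary multipliers of the tensor square -/

section Slices

variable {A : Type*} [NonUnitalRing A] [Module ℂ A] [IsScalarTower ℂ A A] [SMulCommClass ℂ A A]

@[simp] theorem sliceLeft_tmul (ω : A →ₗ[ℂ] ℂ) (a b : A) :
    sliceLeft ω (a ⊗ₜ[ℂ] b) = ω a • b := by simp [sliceLeft]

@[simp] theorem sliceRight_tmul (ω : A →ₗ[ℂ] ℂ) (a b : A) :
    sliceRight ω (a ⊗ₜ[ℂ] b) = ω b • a := by simp [sliceRight]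

theorem apply_sliceLeft (ω χ : A →ₗ[ℂ] ℂ) (X : A ⊗[ℂ] A) :
    ω (sliceLeft χ X) = χ (sliceRight ω X) := by
  induction X with
  | zero => simp
  | add X Y hX hY => simp only [map_add, hX, hY]
  | tmul x y => simp [mul_comm]

theorem sliceLeft_map (ω : A →ₗ[ℂ] ℂ) (f g : A →ₗ[ℂ] A) (X : A ⊗[ℂ] A) :
    sliceLeft ω (TensorProduct.map f g X) = g (sliceLeft (ω ∘ₗ f) X) := by
  induction X with
  | zero => simp
  | add X Y hX hY => simp only [map_add, hX, hY]
  | tmul x y => simp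

theorem sliceRight_map (ω : A →ₗ[ℂ] ℂ) (f g : A →ₗ[ℂ] A) (X : A ⊗[ℂ] A) :
    sliceRight ω (TensorProduct.map f g X) = f (sliceRight (ω ∘ₗ g) X) := by
  induction X with
  | zero => simp
  | add X Y hX hY => simp only [map_add, hX, hY]
  | tmul x y => simp

theorem sliceLeft_lTensor (ω : A →ₗ[ℂ] ℂ) (f : A →ₗ[ℂ] A) (X : A ⊗[ℂ] A) :
    sliceLeft ω (f.lTensor A X) = f (sliceLeft ω X) :=
  sliceLeft_map ω .id f X

theorem sliceLeft_rTensor (ω : A →ₗ[ℂ] ℂ) (f : A →ₗ[ℂ] A) (X : A ⊗[ℂ] A) :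
    sliceLeft ω (f.rTensor A X) = sliceLeft (ω ∘ₗ f) X :=
  sliceLeft_map ω f .id X

theorem sliceRight_lTensor (ω : A →ₗ[ℂ] ℂ) (f : A →ₗ[ℂ] A) (X : A ⊗[ℂ] A) :
    sliceRight ω (f.lTensor A X) = sliceRight (ω ∘ₗ f) X :=
  sliceRight_map ω .id f X

theorem sliceLeft_left_tmulOne (ω : A →ₗ[ℂ] ℂ) (a : A) (X : A ⊗[ℂ] A) :
    sliceLeft ω ((tmulOne a).left X) = sliceLeft (ω ∘ₗ LinearMap.mulLeft ℂ a) X :=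
  sliceLeft_map ω (LinearMap.mulLeft ℂ a) .id X

theorem sliceLeft_left_oneTmul (ω : A →ₗ[ℂ] ℂ) (a : A) (X : A ⊗[ℂ] A) :
    sliceLeft ω ((oneTmul a).left X) = a * sliceLeft ω X :=
  sliceLeft_map ω .id (LinearMap.mulLeft ℂ a) X

theorem sliceLeft_right_oneTmul (ω : A →ₗ[ℂ] ℂ) (a : A) (X : A ⊗[ℂ] A) :
    sliceLeft ω ((oneTmul a).right X) = sliceLeft ω X * a :=
  sliceLeft_map ω .id (LinearMap.mulRight ℂ a) X

theorem sliceRight_left_tmulOne (ω : A →ₗ[ℂ] ℂ) (a : A) (X : A ⊗[ℂ] A) :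
    sliceRight ω ((tmulOne a).left X) = a * sliceRight ω X :=
  sliceRight_map ω (LinearMap.mulLeft ℂ a) .id X

theorem sliceRight_right_tmulOne (ω : A →ₗ[ℂ] ℂ) (a : A) (X : A ⊗[ℂ] A) :
    sliceRight ω ((tmulOne a).right X) = sliceRight ω X * a :=
  sliceRight_map ω (LinearMap.mulRight ℂ a) .id X

theorem sliceRight_left_oneTmul (ω : A →ₗ[ℂ] ℂ) (a : A) (X : A ⊗[ℂ] A) :
    sliceRight ω ((oneTmul a).left X) = sliceRight (ω ∘ₗ LinearMap.mulLeft ℂ a) X :=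
  sliceRight_map ω .id (LinearMap.mulLeft ℂ a) X

theorem sliceRight_right_oneTmul (ω : A →ₗ[ℂ] ℂ) (a : A) (X : A ⊗[ℂ] A) :
    sliceRight ω ((oneTmul a).right X) = sliceRight (ω ∘ₗ LinearMap.mulRight ℂ a) X :=
  sliceRight_map ω .id (LinearMap.mulRight ℂ a) X

theorem functional_ext {a b : A} (h : ∀ ω : A →ₗ[ℂ] ℂ, ω a = ω b) : a = b :=
  sub_eq_zero.1 <| (Module.forall_dual_apply_eq_zero_iff ℂ (a - b)).1 fun ω => by
    rw [map_sub, h, sub_self]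

theorem sliceRight_ext {X Y : A ⊗[ℂ] A} (h : ∀ ω : A →ₗ[ℂ] ℂ, sliceRight ω X = sliceRight ω Y) :
    X = Y := by
  classical
  let b := Module.Basis.ofVectorSpace ℂ A
  apply (TensorProduct.equivFinsuppOfBasisRight (M := A) b).injective
  ext i
  have key (Z : A ⊗[ℂ] A) :
      TensorProduct.equivFinsuppOfBasisRight b Z i = sliceRight (b.coord i) Z := by
    induction Z with
    | zero => simp
    | add Z W hZ hW => simp only [map_add, Finsupp.add_apply, hZ, hW]
    | tmul x y => simp
  rw [key, key, h]

theorem sliceLeft_ext {X Y : A ⊗[ℂ] A} (h : ∀ ω : A →ₗ[ℂ] ℂ, sliceLeft ω X = sliceLeft ω Y) :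
    X = Y :=
  sliceRight_ext fun ω => functional_ext fun χ => by
    rw [← apply_sliceLeft, ← apply_sliceLeft, h]

/-- A tensor whose right slices along `φ (e · )` all vanish is killed by `φ ∘ m ∘ (κ ⊗ ι)`. -/
theorem apply_mul'_rTensor_eq_zero (φ : A →ₗ[ℂ] ℂ) {X : A ⊗[ℂ] A}
    (h : ∀ e, sliceRight (φ ∘ₗ LinearMap.mulLeft ℂ e) X = 0) (κ : A →ₗ[ℂ] A) :
    φ (LinearMap.mul' ℂ A (κ.rTensor A X)) = 0 := by
  classical
  let b := Module.Basis.ofVectorSpace ℂ A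
  have hX : X = (TensorProduct.equivFinsuppOfBasisLeft (N := A) b X).sum fun i m => b i ⊗ₜ m := by
    rw [← TensorProduct.equivFinsuppOfBasisLeft_symm_apply, LinearEquiv.symm_apply_apply]
  have key (Z : A ⊗[ℂ] A) (i) :
      TensorProduct.equivFinsuppOfBasisLeft b Z i = sliceLeft (b.coord i) Z := by
    induction Z with
    | zero => simp
    | add Z W hZ hW => simp only [map_add, Finsupp.add_apply, hZ, hW]
    | tmul x y => simp
  rw [hX, Finsupp.sum, map_sum, map_sum, map_sum]
  refine Finset.sum_eq_zero fun i _ => ?_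
  rw [key]
  have := apply_sliceLeft (φ ∘ₗ LinearMap.mulLeft ℂ (κ (b i))) (b.coord i) X
  rw [h, map_zero] at this
  simpa using this

theorem mul_tmul (X : A ⊗[ℂ] A) (x y : A) :
    X * x ⊗ₜ[ℂ] y = (oneTmul y).right ((tmulOne x).right X) := by
  induction X with
  | zero => simp
  | add X Y hX hY => simp only [map_add, add_mul, hX, hY]
  | tmul x y => simp

theorem tmul_mul (X : A ⊗[ℂ] A) (x y : A) :
    x ⊗ₜ[ℂ] y * X = (oneTmul y).left ((tmulOne x).left X) := by
  induction X with
  | zero => simp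
  | add X Y hX hY => simp only [map_add, mul_add, hX, hY]
  | tmul x y => simp

theorem ofElem_tmul (a b : A) :
    MultiplierAlg.ofElem (a ⊗ₜ[ℂ] b) = tmulOne a * oneTmul b := by
  ext X
  · simp only [MultiplierAlg.left_ofElem, MultiplierAlg.left_mul]
    induction X with
    | zero => simp
    | add X Y hX hY => simp only [map_add, mul_add, hX, hY]
    | tmul x y => simp
  · simp only [MultiplierAlg.right_ofElem, MultiplierAlg.right_mul]
    rw [mul_tmul]

theorem tmulOne_mul_oneTmul (a b : A) : tmulOne a * oneTmul b = oneTmul b * tmulOne a := by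
  ext X
  · simp only [MultiplierAlg.left_mul]
    induction X with
    | zero => simp
    | add X Y hX hY => simp only [map_add, hX, hY]
    | tmul x y => simp
  · simp only [MultiplierAlg.right_mul]
    induction X with
    | zero => simp
    | add X Y hX hY => simp only [map_add, hX, hY]
    | tmul x y => simp

theorem oneTmul_mul (a b : A) : oneTmul (a * b) = oneTmul a * oneTmul b := by
  ext X
  · simp only [MultiplierAlg.left_mul]
    induction X with
    | zero => simp
    | add X Y hX hY => simp only [map_add, hX, hY]
    | tmul x y => simp [mul_assoc]
  · simp only [MultiplierAlg.right_mul]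
    induction X with
    | zero => simp
    | add X Y hX hY => simp only [map_add, hX, hY]
    | tmul x y => simp [mul_assoc]

end Slices

/-! ### Cancellation in the tensor square and the four canonical maps -/

section Basic

variable {A : Type*} [NonUnitalRing A] [StarRing A] [Module ℂ A]
    [IsScalarTower ℂ A A] [SMulCommClass ℂ A A] [StarModule ℂ A]
    (H : MultiplierHopfStarAlgebra A)

section Cancellation

include H

theorem mul_right_ext {a b : A} (h : ∀ c, a * c = b * c) : a = b :=
  sub_eq_zero.1 <| H.eq_zero_of_mul_right _ fun c => by rw [sub_mul, h, sub_self]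

theorem mul_left_ext {a b : A} (h : ∀ c, c * a = c * b) : a = b :=
  sub_eq_zero.1 <| H.eq_zero_of_mul_left _ fun c => by rw [mul_sub, h, sub_self]

theorem left_tmulOne_ext {X Y : A ⊗[ℂ] A} (h : ∀ a, (tmulOne a).left X = (tmulOne a).left Y) :
    X = Y :=
  sliceRight_ext fun ω => H.mul_left_ext fun c => by
    rw [← sliceRight_left_tmulOne, h, sliceRight_left_tmulOne]

theorem right_tmulOne_ext {X Y : A ⊗[ℂ] A} (h : ∀ a, (tmulOne a).right X = (tmulOne a).right Y) :
    X = Y :=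
  sliceRight_ext fun ω => H.mul_right_ext fun c => by
    rw [← sliceRight_right_tmulOne, h, sliceRight_right_tmulOne]

theorem left_oneTmul_ext {X Y : A ⊗[ℂ] A} (h : ∀ a, (oneTmul a).left X = (oneTmul a).left Y) :
    X = Y :=
  sliceLeft_ext fun ω => H.mul_left_ext fun c => by
    rw [← sliceLeft_left_oneTmul, h, sliceLeft_left_oneTmul]

theorem right_oneTmul_ext {X Y : A ⊗[ℂ] A} (h : ∀ a, (oneTmul a).right X = (oneTmul a).right Y) :
    X = Y :=
  sliceLeft_ext fun ω => H.mul_right_ext fun c => by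
    rw [← sliceLeft_right_oneTmul, h, sliceLeft_right_oneTmul]

theorem tensor_mul_right_ext {X Y : A ⊗[ℂ] A} (h : ∀ Z, X * Z = Y * Z) : X = Y :=
  H.right_tmulOne_ext fun x => H.right_oneTmul_ext fun y => by rw [← mul_tmul, h, mul_tmul]

theorem tensor_mul_left_ext {X Y : A ⊗[ℂ] A} (h : ∀ Z, Z * X = Z * Y) : X = Y :=
  H.left_tmulOne_ext fun x => H.left_oneTmul_ext fun y => by rw [← tmul_mul, h, tmul_mul]

theorem ofElem_injective :
    Function.Injective (MultiplierAlg.ofElem : A ⊗[ℂ] A → MultiplierAlg (A ⊗[ℂ] A)) :=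
  fun _ _ h => H.tensor_mul_right_ext fun Z => congrArg (fun m => m.left Z) h

theorem left_mul_assoc (m : MultiplierAlg (A ⊗[ℂ] A)) (X Y : A ⊗[ℂ] A) :
    m.left (X * Y) = m.left X * Y :=
  H.tensor_mul_left_ext fun Z => by
    rw [← MultiplierAlg.right_mul_eq, ← mul_assoc, ← mul_assoc, MultiplierAlg.right_mul_eq]

theorem right_mul_assoc (m : MultiplierAlg (A ⊗[ℂ] A)) (X Y : A ⊗[ℂ] A) :
    m.right (X * Y) = X * m.right Y :=
  H.tensor_mul_right_ext fun Z => by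
    rw [MultiplierAlg.right_mul_eq, mul_assoc, mul_assoc, MultiplierAlg.right_mul_eq]

theorem ofElem_left (m : MultiplierAlg (A ⊗[ℂ] A)) (X : A ⊗[ℂ] A) :
    MultiplierAlg.ofElem (m.left X) = m * MultiplierAlg.ofElem X := by
  ext Y
  · simp [H.left_mul_assoc]
  · simp [MultiplierAlg.right_mul_eq]

theorem ofElem_right (m : MultiplierAlg (A ⊗[ℂ] A)) (X : A ⊗[ℂ] A) :
    MultiplierAlg.ofElem (m.right X) = MultiplierAlg.ofElem X * m := by
  ext Y
  · simp [MultiplierAlg.right_mul_eq]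
  · simp [H.right_mul_assoc]

end Cancellation

/-- The map `b ⊗ a ↦ Δ(a)(b ⊗ 1)`. -/
def T₃ : A ⊗[ℂ] A →ₗ[ℂ] A ⊗[ℂ] A := MultiplierAlg.conjMap H.T₂.toLinearMap

/-- The map `a ⊗ b ↦ (1 ⊗ b)Δ(a)`. -/
def T₄ : A ⊗[ℂ] A →ₗ[ℂ] A ⊗[ℂ] A := MultiplierAlg.conjMap H.T₁.toLinearMap

theorem T₃_apply (X : A ⊗[ℂ] A) : H.T₃ X = star (H.T₂ (star X)) := rfl

theorem T₄_apply (X : A ⊗[ℂ] A) : H.T₄ X = star (H.T₁ (star X)) := rfl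

theorem T₃_surjective : Function.Surjective H.T₃ := fun X =>
  ⟨star (H.T₂.symm (star X)), by simp [T₃_apply]⟩

theorem T₄_surjective : Function.Surjective H.T₄ := fun X =>
  ⟨star (H.T₁.symm (star X)), by simp [T₄_apply]⟩

theorem ofElem_T₃ (a b : A) :
    MultiplierAlg.ofElem (H.T₃ (b ⊗ₜ[ℂ] a)) = H.comul a * tmulOne b :=
  H.ofElem_comulMulTmulOne a b

theorem ofElem_T₄ (a b : A) :
    MultiplierAlg.ofElem (H.T₄ (a ⊗ₜ[ℂ] b)) = oneTmul b * H.comul a :=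
  H.ofElem_oneTmulMulComul b a

/-- The left action of `Δ(a)` on `A ⊗ A`, linear in `a`. -/
def comulLeft : A →ₗ[ℂ] A ⊗[ℂ] A →ₗ[ℂ] A ⊗[ℂ] A where
  toFun a := (H.comul a).left
  map_add' a b := by ext; simp
  map_smul' c a := by ext; simp

theorem comulLeft_apply (a : A) (X : A ⊗[ℂ] A) : H.comulLeft a X = (H.comul a).left X := rfl

theorem T₁_mul_tmul (a b c : A) :
    H.T₁ ((a * b) ⊗ₜ[ℂ] c) = H.comulLeft a (H.T₁ (b ⊗ₜ[ℂ] c)) := by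
  apply H.ofElem_injective
  rw [comulLeft_apply, H.ofElem_left, ofElem_T₁, ofElem_T₁, map_mul, mul_assoc]

theorem T₃_tmul_mul (a b c : A) :
    H.T₃ (c ⊗ₜ[ℂ] (a * b)) = H.comulLeft a (H.T₃ (c ⊗ₜ[ℂ] b)) := by
  apply H.ofElem_injective
  rw [comulLeft_apply, H.ofElem_left, ofElem_T₃, ofElem_T₃, map_mul, mul_assoc]

theorem comulLeft_tmul (a x y : A) :
    H.comulLeft a (x ⊗ₜ[ℂ] y) = (tmulOne x).right (H.T₁ (a ⊗ₜ[ℂ] y)) := by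
  apply H.ofElem_injective
  rw [comulLeft_apply, H.ofElem_left, H.ofElem_right, ofElem_T₁, ofElem_tmul, mul_assoc,
    tmulOne_mul_oneTmul]

theorem comulLeft_tmul' (a x y : A) :
    H.comulLeft a (x ⊗ₜ[ℂ] y) = (oneTmul y).right (H.T₃ (x ⊗ₜ[ℂ] a)) := by
  apply H.ofElem_injective
  rw [comulLeft_apply, H.ofElem_left, H.ofElem_right, ofElem_T₃, ofElem_tmul, mul_assoc]

theorem right_oneTmul_T₂ (a b c : A) :
    (oneTmul c).right (H.T₂ (a ⊗ₜ[ℂ] b)) = (tmulOne a).left (H.T₁ (b ⊗ₜ[ℂ] c)) := by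
  apply H.ofElem_injective
  rw [H.ofElem_left, H.ofElem_right, ofElem_T₁, ofElem_T₂, mul_assoc]

theorem right_tmulOne_T₂ (a b c : A) :
    (tmulOne c).right (H.T₂ (a ⊗ₜ[ℂ] b)) = (tmulOne a).left (H.T₃ (c ⊗ₜ[ℂ] b)) := by
  apply H.ofElem_injective
  rw [H.ofElem_left, H.ofElem_right, ofElem_T₃, ofElem_T₂, mul_assoc]

theorem right_oneTmul_T₁ (a b c : A) :
    (oneTmul c).right (H.T₁ (a ⊗ₜ[ℂ] b)) = H.T₁ (a ⊗ₜ[ℂ] (b * c)) := by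
  apply H.ofElem_injective
  rw [H.ofElem_right, ofElem_T₁, ofElem_T₁, oneTmul_mul, mul_assoc]

theorem right_oneTmul_T₄ (a b c : A) :
    (oneTmul c).right (H.T₄ (a ⊗ₜ[ℂ] b)) = (oneTmul b).left (H.T₁ (a ⊗ₜ[ℂ] c)) := by
  apply H.ofElem_injective
  rw [H.ofElem_left, H.ofElem_right, ofElem_T₁, ofElem_T₄, mul_assoc]

theorem right_tmulOne_T₄ (a b c : A) :
    (tmulOne c).right (H.T₄ (a ⊗ₜ[ℂ] b)) = (oneTmul b).left (H.T₃ (c ⊗ₜ[ℂ] a)) := by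
  apply H.ofElem_injective
  rw [H.ofElem_left, H.ofElem_right, ofElem_T₃, ofElem_T₄, mul_assoc]

theorem left_tmulOne_comulLeft (a b : A) (X : A ⊗[ℂ] A) :
    (tmulOne a).left (H.comulLeft b X) = H.T₂ (a ⊗ₜ[ℂ] b) * X := by
  apply H.ofElem_injective
  rw [comulLeft_apply, H.ofElem_left, H.ofElem_left, ← MultiplierAlg.left_ofElem, H.ofElem_left,
    ofElem_T₂, mul_assoc]

end Basic


section

variable {A : Type*} [NonUnitalRing A] [StarRing A] [Module ℂ A]
    [IsScalarTower ℂ A A] [SMulCommClass ℂ A A] [StarModule ℂ A]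
    (H : MultiplierHopfStarAlgebra A)

/-! ### Coassociativity in sliced form -/

section Coassociativity

theorem coassoc_tensor (a : A) (W : A ⊗[ℂ] A) :
    TensorProduct.assoc ℂ A A A (H.T₂.toLinearMap.rTensor A
        ((TensorProduct.assoc ℂ A A A).symm (a ⊗ₜ[ℂ] H.T₁ W))) =
      H.T₁.toLinearMap.lTensor A (TensorProduct.assoc ℂ A A A (H.T₂.toLinearMap.rTensor A
        ((TensorProduct.assoc ℂ A A A).symm (a ⊗ₜ[ℂ] W)))) := by
  induction W with
  | zero => simp
  | add W W' h h' => simp only [map_add, TensorProduct.tmul_add, h, h']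
  | tmul b c =>
    rw [H.coassoc]
    simp

/-- The map `b ↦ (ι ⊗ ω)(Δ(b)(1 ⊗ c))`. -/
def convRight (ω : A →ₗ[ℂ] ℂ) (c : A) : A →ₗ[ℂ] A :=
  sliceRight ω ∘ₗ H.T₁.toLinearMap ∘ₗ (TensorProduct.mk ℂ A A).flip c

/-- The map `b ↦ (ω ⊗ ι)((a ⊗ 1)Δ(b))`. -/
def convLeft (ω : A →ₗ[ℂ] ℂ) (a : A) : A →ₗ[ℂ] A :=
  sliceLeft ω ∘ₗ H.T₂.toLinearMap ∘ₗ TensorProduct.mk ℂ A A a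

theorem convRight_apply (ω : A →ₗ[ℂ] ℂ) (b c : A) :
    H.convRight ω c b = sliceRight ω (H.T₁ (b ⊗ₜ[ℂ] c)) := rfl

theorem convLeft_apply (ω : A →ₗ[ℂ] ℂ) (a b : A) :
    H.convLeft ω a b = sliceLeft ω (H.T₂ (a ⊗ₜ[ℂ] b)) := rfl

/-- Coassociativity with the last leg sliced by ω. Because of it, φ composed with a right
convolution is again left invariant. -/
theorem T₂_tmul_convRight (ω : A →ₗ[ℂ] ℂ) (a b c : A) :
    H.T₂ (a ⊗ₜ[ℂ] H.convRight ω c b) = (H.convRight ω c).lTensor A (H.T₂ (a ⊗ₜ[ℂ] b)) := by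
  have h := congrArg ((sliceRight ω).lTensor A) (H.coassoc a b c)
  have h₁ (Y : A ⊗[ℂ] A) (v : A) :
      (sliceRight ω).lTensor A (TensorProduct.assoc ℂ A A A (Y ⊗ₜ[ℂ] v)) = ω v • Y := by
    induction Y with
    | zero => simp
    | add Y Y' h h' => simp only [map_add, TensorProduct.add_tmul, smul_add, h, h']
    | tmul x y => simp [TensorProduct.tmul_smul]
  have h₂ (X : A ⊗[ℂ] A) :
      (sliceRight ω).lTensor A (TensorProduct.assoc ℂ A A A (H.T₂.toLinearMap.rTensor A
        ((TensorProduct.assoc ℂ A A A).symm (a ⊗ₜ[ℂ] X)))) = H.T₂ (a ⊗ₜ[ℂ] sliceRight ω X) := by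
    induction X with
    | zero => simp
    | add Y Y' h h' => simp only [map_add, TensorProduct.tmul_add, h, h']
    | tmul x y => simp [h₁, TensorProduct.tmul_smul]
  have h₃ (Y : A ⊗[ℂ] A) :
      (sliceRight ω).lTensor A (H.T₁.toLinearMap.lTensor A
        (TensorProduct.assoc ℂ A A A (Y ⊗ₜ[ℂ] c))) = (H.convRight ω c).lTensor A Y := by
    induction Y with
    | zero => simp
    | add Y Y' h h' => simp only [map_add, TensorProduct.add_tmul, h, h']
    | tmul x y => simp [convRight_apply]
  rw [h₂, h₃] at h
  exact h

theorem T₁_convLeft_tmul (ω : A →ₗ[ℂ] ℂ) (a b c : A) :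
    H.T₁ (H.convLeft ω a b ⊗ₜ[ℂ] c) = (H.convLeft ω a).rTensor A (H.T₁ (b ⊗ₜ[ℂ] c)) := by
  let s : A ⊗[ℂ] (A ⊗[ℂ] A) →ₗ[ℂ] A ⊗[ℂ] A :=
    (TensorProduct.lid ℂ (A ⊗[ℂ] A)).toLinearMap ∘ₗ ω.rTensor (A ⊗[ℂ] A)
  have h := congrArg s (H.coassoc a b c)
  have h₁ (Y : A ⊗[ℂ] A) (v : A) :
      s (TensorProduct.assoc ℂ A A A (Y ⊗ₜ[ℂ] v)) = sliceLeft ω Y ⊗ₜ[ℂ] v := by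
    induction Y with
    | zero => simp
    | add Y Y' h h' => simp only [map_add, TensorProduct.add_tmul, h, h']
    | tmul x y => simp [s, TensorProduct.smul_tmul']
  have h₂ (X : A ⊗[ℂ] A) :
      s (TensorProduct.assoc ℂ A A A (H.T₂.toLinearMap.rTensor A
        ((TensorProduct.assoc ℂ A A A).symm (a ⊗ₜ[ℂ] X)))) = (H.convLeft ω a).rTensor A X := by
    induction X with
    | zero => simp
    | add Y Y' h h' => simp only [map_add, TensorProduct.tmul_add, h, h']
    | tmul x y => simp [h₁, convLeft_apply]
  have h₃ (Y : A ⊗[ℂ] A) :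
      s (H.T₁.toLinearMap.lTensor A (TensorProduct.assoc ℂ A A A (Y ⊗ₜ[ℂ] c))) =
        H.T₁ (sliceLeft ω Y ⊗ₜ[ℂ] c) := by
    induction Y with
    | zero => simp
    | add Y Y' h h' => simp only [map_add, TensorProduct.add_tmul, h, h']
    | tmul x y =>
      simp only [s, TensorProduct.assoc_tmul, LinearMap.lTensor_tmul, LinearMap.comp_apply,
        LinearMap.rTensor_tmul, LinearEquiv.coe_coe, TensorProduct.lid_tmul, sliceLeft_tmul]
      rw [← TensorProduct.smul_tmul', map_smul]
  rw [h₂, h₃] at h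
  exact h.symm

theorem right_tmulOne_lTensor (f : A →ₗ[ℂ] A) (c : A) (X : A ⊗[ℂ] A) :
    (tmulOne c).right (f.lTensor A X) = f.lTensor A ((tmulOne c).right X) := by
  induction X with
  | zero => simp
  | add Y Y' h h' => simp only [map_add, h, h']
  | tmul x y => simp

theorem left_tmulOne_lTensor (f : A →ₗ[ℂ] A) (c : A) (X : A ⊗[ℂ] A) :
    (tmulOne c).left (f.lTensor A X) = f.lTensor A ((tmulOne c).left X) := by
  induction X with
  | zero => simp
  | add Y Y' h h' => simp only [map_add, h, h']
  | tmul x y => simp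

theorem T₃_tmul_convRight (ω : A →ₗ[ℂ] ℂ) (a b c : A) :
    H.T₃ (a ⊗ₜ[ℂ] H.convRight ω c b) = (H.convRight ω c).lTensor A (H.T₃ (a ⊗ₜ[ℂ] b)) :=
  H.left_tmulOne_ext fun d => by
    rw [← right_tmulOne_T₂, T₂_tmul_convRight, right_tmulOne_lTensor, right_tmulOne_T₂,
      left_tmulOne_lTensor]

/-- The functional `a ↦ (ω (a*))*`. -/
def starFunctional (ω : A →ₗ[ℂ] ℂ) : A →ₗ[ℂ] ℂ where
  toFun a := star (ω (star a))
  map_add' a b := by simp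
  map_smul' c a := by simp

theorem starFunctional_apply (ω : A →ₗ[ℂ] ℂ) (a : A) :
    starFunctional ω a = star (ω (star a)) := rfl

theorem sliceRight_star (ω : A →ₗ[ℂ] ℂ) (X : A ⊗[ℂ] A) :
    sliceRight ω (star X) = star (sliceRight (starFunctional ω) X) := by
  induction X with
  | zero => simp
  | add Y Y' h h' => simp only [map_add, star_add, h, h']
  | tmul x y => simp [starFunctional_apply]

theorem sliceLeft_star (ω : A →ₗ[ℂ] ℂ) (X : A ⊗[ℂ] A) :
    sliceLeft ω (star X) = star (sliceLeft (starFunctional ω) X) := by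
  induction X with
  | zero => simp
  | add Y Y' h h' => simp only [map_add, star_add, h, h']
  | tmul x y => simp [starFunctional_apply]

/-- The map `b ↦ (ι ⊗ ω)((1 ⊗ c)Δ(b))`. -/
def convRight' (ω : A →ₗ[ℂ] ℂ) (c : A) : A →ₗ[ℂ] A :=
  sliceRight ω ∘ₗ H.T₄ ∘ₗ (TensorProduct.mk ℂ A A).flip c

theorem convRight'_apply (ω : A →ₗ[ℂ] ℂ) (b c : A) :
    H.convRight' ω c b = sliceRight ω (H.T₄ (b ⊗ₜ[ℂ] c)) := rfl

theorem convRight'_star (ω : A →ₗ[ℂ] ℂ) (b c : A) :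
    H.convRight' ω c (star b) = star (H.convRight (starFunctional ω) (star c) b) := by
  simp [convRight'_apply, convRight_apply, T₄_apply, sliceRight_star]

theorem T₃_tmul_convRight' (ω : A →ₗ[ℂ] ℂ) (a b c : A) :
    H.T₃ (a ⊗ₜ[ℂ] H.convRight' ω c b) = (H.convRight' ω c).lTensor A (H.T₃ (a ⊗ₜ[ℂ] b)) := by
  have h₁ (X : A ⊗[ℂ] A) : (H.convRight' ω c).lTensor A (star X) =
      star ((H.convRight (starFunctional ω) (star c)).lTensor A X) := by
    induction X with
    | zero => simp
    | add Y Y' h h' => simp only [map_add, star_add, h, h']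
    | tmul x y => simp [convRight'_star]
  have h := H.T₂_tmul_convRight (starFunctional ω) (star a) (star b) (star c)
  have hb : H.convRight' ω c b = star (H.convRight (starFunctional ω) (star c) (star b)) := by
    rw [← convRight'_star, star_star]
  rw [hb, T₃_apply, T₃_apply, h₁, TensorProduct.star_tmul, TensorProduct.star_tmul, star_star, h]

/-- `a p₁ ⊗ p₂ r ⊗ p₃ s`, with the last leg sliced, evaluated in two ways. -/
theorem left_tmulOne_T₁_comm (ω : A →ₗ[ℂ] ℂ) (a p : A) (f : A →ₗ[ℂ] A)
    (hf : ∀ s, f s = sliceRight ω (H.T₁ (p ⊗ₜ[ℂ] s))) (X : A ⊗[ℂ] A) :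
    (tmulOne a).left (H.T₁ (TensorProduct.comm ℂ A A (f.lTensor A X))) =
      (sliceRight ω ∘ₗ H.comulLeft.flip X).lTensor A (H.T₂ (a ⊗ₜ[ℂ] p)) := by
  induction X with
  | zero => simp
  | add Y Y' h h' =>
    simp only [map_add, h, h', LinearMap.comp_add, LinearMap.lTensor_add, LinearMap.add_apply]
  | tmul r s =>
    have hY (Y : A ⊗[ℂ] A) : (sliceRight ω ∘ₗ H.comulLeft.flip (r ⊗ₜ[ℂ] s)).lTensor A Y =
        (oneTmul r).right ((H.convRight ω s).lTensor A Y) := by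
      induction Y with
      | zero => simp
      | add Y Y' h h' => simp only [map_add, h, h']
      | tmul u v => simp [comulLeft_tmul, sliceRight_right_tmulOne, convRight_apply]
    rw [hY, ← T₂_tmul_convRight, right_oneTmul_T₂, convRight_apply]
    simp [hf]

end Coassociativity

/-! ### Existence, uniqueness and multiplicativity of the counit -/

section Counit

/-- Take T₁W = b⊗c in coassociativity, cancel `T₁` on the last two legs and multiply them: the
result is (a⊗1)T₁W = ab⊗c. Comparing the two sides shows that m∘T₁⁻¹ and m∘T₂⁻¹ are slices by one
functional, the future counit. -/
theorem tmul_mul'_T₁_symm (X : A ⊗[ℂ] A) (c : A) :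
    (LinearMap.mul' ℂ A ∘ₗ H.T₁.symm.toLinearMap).lTensor A
        (TensorProduct.assoc ℂ A A A (X ⊗ₜ[ℂ] c)) =
      LinearMap.mul' ℂ A (H.T₂.symm X) ⊗ₜ[ℂ] c := by
  obtain ⟨Z, rfl⟩ := H.T₂.surjective X
  rw [LinearEquiv.symm_apply_apply]
  induction Z with
  | zero => simp
  | add Y Y' h h' => simp only [map_add, TensorProduct.add_tmul, h, h']
  | tmul a b =>
    obtain ⟨W, hW⟩ := H.T₁.surjective (b ⊗ₜ[ℂ] c)
    have h := H.coassoc_tensor a W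
    rw [hW] at h
    have h₁ (X : A ⊗[ℂ] (A ⊗[ℂ] A)) :
        (LinearMap.mul' ℂ A ∘ₗ H.T₁.symm.toLinearMap).lTensor A (H.T₁.toLinearMap.lTensor A X) =
          (LinearMap.mul' ℂ A).lTensor A X := by
      induction X with
      | zero => simp
      | add Y Y' h h' => simp only [map_add, h, h']
      | tmul u v => simp
    have h₂ (Y : A ⊗[ℂ] A) (q : A) : (LinearMap.mul' ℂ A).lTensor A
        (TensorProduct.assoc ℂ A A A (Y ⊗ₜ[ℂ] q)) = (oneTmul q).right Y := by
      induction Y with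
      | zero => simp
      | add Y Y' h h' => simp only [map_add, TensorProduct.add_tmul, h, h']
      | tmul u v => simp
    have h₃ (W : A ⊗[ℂ] A) : (LinearMap.mul' ℂ A).lTensor A
        (TensorProduct.assoc ℂ A A A (H.T₂.toLinearMap.rTensor A
          ((TensorProduct.assoc ℂ A A A).symm (a ⊗ₜ[ℂ] W)))) = (tmulOne a).left (H.T₁ W) := by
      induction W with
      | zero => simp
      | add Y Y' h h' => simp only [map_add, TensorProduct.tmul_add, h, h']
      | tmul u v => simp [h₂, right_oneTmul_T₂]
    simp only [TensorProduct.assoc_symm_tmul, LinearMap.rTensor_tmul, LinearEquiv.coe_coe] at h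
    rw [h, h₁, h₃, hW]
    simp

theorem exists_isCounit [Nontrivial A] : ∃ ε : A →ₗ[ℂ] ℂ, H.IsCounit ε := by
  obtain ⟨x, hx⟩ := exists_ne (0 : A)
  obtain ⟨f, hf⟩ : ∃ f : A →ₗ[ℂ] ℂ, f x = 1 := by
    by_contra! h
    refine hx ((Module.forall_dual_apply_eq_zero_iff ℂ x).1 fun f => ?_)
    by_contra hf
    exact h ((f x)⁻¹ • f) (by simp [hf])
  -- As f x = 1, slicing the first leg of the preceding identity at x⊗y⊗c by f leaves m(T₁⁻¹(y⊗c))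
  -- equal to a scalar times c; that scalar is ε(y).
  let ε : A →ₗ[ℂ] ℂ := f ∘ₗ LinearMap.mul' ℂ A ∘ₗ H.T₂.symm.toLinearMap ∘ₗ
    TensorProduct.mk ℂ A A x
  have h₁ (y c : A) : LinearMap.mul' ℂ A (H.T₁.symm (y ⊗ₜ[ℂ] c)) = ε y • c := by
    have h := congrArg (sliceLeft f) (H.tmul_mul'_T₁_symm (x ⊗ₜ[ℂ] y) c)
    simpa [hf, ε] using h
  have h₂ (X : A ⊗[ℂ] A) : LinearMap.mul' ℂ A (H.T₁.symm X) = sliceLeft ε X := by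
    induction X with
    | zero => simp
    | add Y Y' h h' => simp only [map_add, h, h']
    | tmul u v => simp [h₁]
  have h₃ (X : A ⊗[ℂ] A) : LinearMap.mul' ℂ A (H.T₂.symm X) = sliceRight ε X := by
    have h' (X : A ⊗[ℂ] A) : sliceRight f
        ((LinearMap.mul' ℂ A ∘ₗ H.T₁.symm.toLinearMap).lTensor A
          (TensorProduct.assoc ℂ A A A (X ⊗ₜ[ℂ] x))) = sliceRight ε X := by
      induction X with
      | zero => simp
      | add Y Y' h h' => simp only [map_add, TensorProduct.add_tmul, h, h']
      | tmul u v => simp [h₁, hf]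
    have h := congrArg (sliceRight f) (H.tmul_mul'_T₁_symm X x)
    rw [h'] at h
    simp [h, hf]
  exact ⟨ε, fun a b => ⟨by simp [← h₂], by simp [← h₃]⟩⟩

variable {H} {ε : A →ₗ[ℂ] ℂ}

theorem IsCounit.sliceLeft_T₁ (hε : H.IsCounit ε) (Z : A ⊗[ℂ] A) :
    sliceLeft ε (H.T₁ Z) = LinearMap.mul' ℂ A Z := by
  induction Z with
  | zero => simp
  | add Y Y' h h' => simp only [map_add, h, h']
  | tmul u v => simp [(hε u v).1]

theorem IsCounit.sliceRight_T₂ (hε : H.IsCounit ε) (Z : A ⊗[ℂ] A) :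
    sliceRight ε (H.T₂ Z) = LinearMap.mul' ℂ A Z := by
  induction Z with
  | zero => simp
  | add Y Y' h h' => simp only [map_add, h, h']
  | tmul u v => simp [(hε u v).2]

theorem IsCounit.unique (hε : H.IsCounit ε) {ε' : A →ₗ[ℂ] ℂ} (hε' : H.IsCounit ε') : ε = ε' := by
  ext a
  by_cases ha : a = 0
  · simp [ha]
  have h : sliceLeft ε (a ⊗ₜ[ℂ] a) = sliceLeft ε' (a ⊗ₜ[ℂ] a) := by
    obtain ⟨Z, hZ⟩ := H.T₁.surjective (a ⊗ₜ[ℂ] a)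
    rw [← hZ, hε.sliceLeft_T₁, hε'.sliceLeft_T₁]
  simp only [sliceLeft_tmul] at h
  exact smul_left_injective ℂ ha h

theorem IsCounit.sliceLeft_comulLeft (hε : H.IsCounit ε) (p : A) (X : A ⊗[ℂ] A) :
    sliceLeft ε (H.comulLeft p X) = p * sliceLeft ε X := by
  obtain ⟨W, rfl⟩ := H.T₁.surjective X
  induction W with
  | zero => simp
  | add Y Y' h h' => simp only [map_add, mul_add, h, h']
  | tmul r t => rw [← T₁_mul_tmul, hε.sliceLeft_T₁, hε.sliceLeft_T₁]; simp [mul_assoc]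

/-- (ε⊗ι)(Δ(p)(y⊗q)) = ε(y)pq = ε(y)(ε⊗ι)(Δ(p)(1⊗q)), and the elements Δ(p)(1⊗q) span A⊗A. -/
theorem IsCounit.map_mul (hε : H.IsCounit ε) (x y : A) : ε (x * y) = ε x * ε y := by
  have key (Z : A ⊗[ℂ] A) :
      sliceLeft ε ((tmulOne y).right (H.T₁ Z)) = ε y • sliceLeft ε (H.T₁ Z) := by
    induction Z with
    | zero => simp
    | add Y Y' h h' => simp only [map_add, smul_add, h, h']
    | tmul p q =>
      rw [← comulLeft_tmul, hε.sliceLeft_comulLeft, hε.sliceLeft_T₁]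
      simp [mul_smul_comm]
  by_cases hx : x = 0
  · simp [hx]
  obtain ⟨Z, hZ⟩ := H.T₁.surjective (x ⊗ₜ[ℂ] x)
  have h := key Z
  rw [hZ] at h
  simp only [right_tmulOne, sliceLeft_tmul, smul_smul] at h
  rw [mul_comm (ε x)]
  exact smul_left_injective ℂ hx h

theorem IsCounit.ne_zero [Nontrivial A] (hε : H.IsCounit ε) : ε ≠ 0 := by
  rintro rfl
  obtain ⟨x, hx⟩ := exists_ne (0 : A)
  refine hx (H.eq_zero_of_mul_right x fun b => ?_)
  rw [← (hε x b).1]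
  simp [sliceLeft]

end Counit

end


section

variable {A : Type*} [NonUnitalRing A] [StarRing A] [Module ℂ A]
    [IsScalarTower ℂ A A] [SMulCommClass ℂ A A] [StarModule ℂ A]
    {H : MultiplierHopfStarAlgebra A}

/-! ### Invariant functionals and convolution -/

section Invariance

variable (H) in
/-- Left invariance `(ι ⊗ θ)Δ(a) = θ(a)1`, tested by multiplication from the right. -/
def IsLeftInvariant (θ : A →ₗ[ℂ] ℂ) : Prop :=
  ∀ a b : A, sliceRight θ (H.T₃ (b ⊗ₜ[ℂ] a)) = θ a • b

variable (H) in
/-- Right invariance `(ψ ⊗ ι)Δ(a) = ψ(a)1`, tested by multiplication from the right. -/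
def IsRightInvariant (ψ : A →ₗ[ℂ] ℂ) : Prop :=
  ∀ a b : A, sliceLeft ψ (H.T₁ (a ⊗ₜ[ℂ] b)) = ψ a • b

theorem IsLeftIntegral.isLeftInvariant {φ : A →ₗ[ℂ] ℂ} (hφ : H.IsLeftIntegral φ) :
    H.IsLeftInvariant φ := fun a b => (hφ.2 a b).1

theorem IsRightInvariant.sliceLeft_T₄ {ψ : A →ₗ[ℂ] ℂ} (hψ : H.IsRightInvariant ψ) (a b : A) :
    sliceLeft ψ (H.T₄ (a ⊗ₜ[ℂ] b)) = ψ a • b :=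
  H.mul_right_ext fun c => by
    rw [← sliceLeft_right_oneTmul, right_oneTmul_T₄, sliceLeft_left_oneTmul, hψ a c,
      mul_smul_comm, smul_mul_assoc]

theorem IsRightInvariant.isRightIntegral {ψ : A →ₗ[ℂ] ℂ} (hψ : H.IsRightInvariant ψ)
    (h0 : ψ ≠ 0) : H.IsRightIntegral ψ :=
  ⟨h0, fun a b => ⟨hψ a b, hψ.sliceLeft_T₄ a b⟩⟩

theorem exists_apply_eq_one {φ : A →ₗ[ℂ] ℂ} (h : φ ≠ 0) : ∃ a, φ a = 1 := by
  obtain ⟨x, hx⟩ : ∃ x, φ x ≠ 0 := by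
    by_contra! h'
    exact h (LinearMap.ext h')
  exact ⟨(φ x)⁻¹ • x, by simp [hx]⟩

theorem sliceRight_surjective {φ : A →ₗ[ℂ] ℂ} (h : φ ≠ 0) :
    Function.Surjective (sliceRight φ) := fun a => by
  obtain ⟨b, hb⟩ := exists_apply_eq_one h
  exact ⟨a ⊗ₜ b, by simp [hb]⟩

/-- For a left invariant `φ`, the functional `φ ∘ (ι ⊗ ω)(Δ( · )(1 ⊗ c))` is left invariant. -/
theorem IsLeftInvariant.comp_convRight {φ : A →ₗ[ℂ] ℂ} (hφ : H.IsLeftInvariant φ)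
    (ω : A →ₗ[ℂ] ℂ) (c : A) : H.IsLeftInvariant (φ ∘ₗ H.convRight ω c) := fun a b => by
  rw [← sliceRight_lTensor, ← T₃_tmul_convRight, hφ, LinearMap.comp_apply]

theorem IsLeftInvariant.comp_convRight' {φ : A →ₗ[ℂ] ℂ} (hφ : H.IsLeftInvariant φ)
    (ω : A →ₗ[ℂ] ℂ) (c : A) : H.IsLeftInvariant (φ ∘ₗ H.convRight' ω c) := fun a b => by
  rw [← sliceRight_lTensor, ← T₃_tmul_convRight', hφ, LinearMap.comp_apply]

end Invariance

/-! ### Construction of the antipode and right invariance of φ∘S -/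

section Antipode

variable {ε φ : A →ₗ[ℂ] ℂ}

/-- In Sweedler notation Δ(f(q₂))(1⊗q₁e) = p₁ ⊗ p₂q₁e φ(p₃q₂), and left invariance applied to p₂q
collapses this to p₁φ(p₂q) ⊗ e. -/
theorem IsLeftInvariant.T₁_comm (hφ : H.IsLeftInvariant φ) (p q e : A) (f : A →ₗ[ℂ] A)
    (hf : ∀ s, f s = sliceRight φ (H.T₁ (p ⊗ₜ[ℂ] s))) :
    H.T₁ (TensorProduct.comm ℂ A A (f.lTensor A (H.T₃ (e ⊗ₜ[ℂ] q)))) = f q ⊗ₜ[ℂ] e := by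
  refine H.left_tmulOne_ext fun a => ?_
  rw [left_tmulOne_T₁_comm H φ a p f hf]
  have hY (Y : A ⊗[ℂ] A) : (sliceRight φ ∘ₗ H.comulLeft.flip (H.T₃ (e ⊗ₜ[ℂ] q))).lTensor A Y =
      sliceRight φ ((oneTmul q).right Y) ⊗ₜ[ℂ] e := by
    induction Y with
    | zero => simp
    | add Y Y' h h' => simp only [map_add, TensorProduct.add_tmul, h, h']
    | tmul u v =>
      simp only [LinearMap.lTensor_tmul, LinearMap.comp_apply, LinearMap.flip_apply,
        right_oneTmul, sliceRight_tmul]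
      rw [← T₃_tmul_mul, hφ, TensorProduct.tmul_smul, TensorProduct.smul_tmul']
  rw [hY, right_oneTmul_T₂, sliceRight_left_tmulOne, hf, left_tmulOne]

/-- Apply (ε⊗ι)T₁⁻¹ to `T₁_comm` and use ε(f(v)) = φ(pv). This is the formula for S before S is
known to exist. -/
theorem IsLeftInvariant.sliceLeft_T₁_symm (hφ : H.IsLeftInvariant φ) (hε : H.IsCounit ε)
    (p q e : A) :
    sliceLeft ε (H.T₁.symm (sliceRight φ (H.T₁ (p ⊗ₜ[ℂ] q)) ⊗ₜ[ℂ] e)) =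
      sliceRight φ (H.T₄ (q ⊗ₜ[ℂ] p)) * e := by
  let f : A →ₗ[ℂ] A := sliceRight φ ∘ₗ H.T₁.toLinearMap ∘ₗ TensorProduct.mk ℂ A A p
  have h := hφ.T₁_comm p q e f fun s => rfl
  change sliceLeft ε (H.T₁.symm (f q ⊗ₜ[ℂ] e)) = _
  rw [← h, LinearEquiv.symm_apply_apply, ← sliceRight_right_tmulOne, right_tmulOne_T₄,
    sliceRight_left_oneTmul]
  have hc (X : A ⊗[ℂ] A) :
      sliceLeft ε (TensorProduct.comm ℂ A A (f.lTensor A X)) =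
        sliceRight (φ ∘ₗ LinearMap.mulLeft ℂ p) X := by
    induction X with
    | zero => simp
    | add Y Y' h h' => simp only [map_add, h, h']
    | tmul u v =>
      have : ε (f v) = φ (p * v) := by
        change ε (sliceRight φ (H.T₁ (p ⊗ₜ[ℂ] v))) = _
        rw [← apply_sliceLeft, hε.sliceLeft_T₁, LinearMap.mul'_apply]
      simp [this]
  exact hc _

/-- The first identity is the hypothesis read through `T₁`. For the second, apply v⊗c ↦ S(v)c to the
last two legs of coassociativity with T₁W = b⊗c. The counit removes the middle leg and leaves a·m(W)
= ε(b)ac. -/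
theorem IsCounit.isAntipode (hε : H.IsCounit ε) {S : A →ₗ[ℂ] A}
    (hS : ∀ x e, S x * e = sliceLeft ε (H.T₁.symm (x ⊗ₜ[ℂ] e))) : H.IsAntipode S := by
  refine ⟨ε, hε, fun a b => ⟨?_, ?_⟩⟩
  · have hX (X : A ⊗[ℂ] A) :
        LinearMap.mul' ℂ A (S.rTensor A X) = sliceLeft ε (H.T₁.symm X) := by
      induction X with
      | zero => simp
      | add Y Y' h h' => simp only [map_add, h, h']
      | tmul u v => simp [hS]
    simp [hX]
  · refine H.mul_right_ext fun c => ?_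
    obtain ⟨W, hW⟩ := H.T₁.surjective (b ⊗ₜ[ℂ] c)
    have h := congrArg (LinearMap.lTensor A (sliceLeft ε ∘ₗ H.T₁.symm.toLinearMap))
      (H.coassoc_tensor a W)
    rw [hW] at h
    have h₁ (X : A ⊗[ℂ] (A ⊗[ℂ] A)) :
        (sliceLeft ε ∘ₗ H.T₁.symm.toLinearMap).lTensor A (H.T₁.toLinearMap.lTensor A X) =
          (sliceLeft ε).lTensor A X := by
      induction X with
      | zero => simp
      | add Y Y' h h' => simp only [map_add, h, h']
      | tmul u v => simp
    have h₂ (Y : A ⊗[ℂ] A) (q : A) : (sliceLeft ε).lTensor A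
        (TensorProduct.assoc ℂ A A A (Y ⊗ₜ[ℂ] q)) = sliceRight ε Y ⊗ₜ[ℂ] q := by
      induction Y with
      | zero => simp
      | add Y Y' h h' => simp only [map_add, TensorProduct.add_tmul, h, h']
      | tmul u v => simp [TensorProduct.smul_tmul']
    have h₃ (W : A ⊗[ℂ] A) : (sliceLeft ε).lTensor A
        (TensorProduct.assoc ℂ A A A (H.T₂.toLinearMap.rTensor A
          ((TensorProduct.assoc ℂ A A A).symm (a ⊗ₜ[ℂ] W)))) = (tmulOne a).left W := by
      induction W with
      | zero => simp
      | add Y Y' h h' => simp only [map_add, TensorProduct.tmul_add, h, h']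
      | tmul u v => simp [h₂, hε.sliceRight_T₂]
    have h₄ (Y : A ⊗[ℂ] A) : LinearMap.mul' ℂ A
        ((sliceLeft ε ∘ₗ H.T₁.symm.toLinearMap).lTensor A
          (TensorProduct.assoc ℂ A A A (Y ⊗ₜ[ℂ] c))) = LinearMap.mul' ℂ A (S.lTensor A Y) * c := by
      induction Y with
      | zero => simp
      | add Y Y' h h' => simp only [map_add, TensorProduct.add_tmul, add_mul, h, h']
      | tmul u v => simp [← hS, mul_assoc]
    have h₅ (W : A ⊗[ℂ] A) : LinearMap.mul' ℂ A ((tmulOne a).left W) =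
        a * LinearMap.mul' ℂ A W := by
      induction W with
      | zero => simp
      | add Y Y' h h' => simp only [map_add, mul_add, h, h']
      | tmul u v => simp [mul_assoc]
    simp only [TensorProduct.assoc_symm_tmul, LinearMap.rTensor_tmul, LinearEquiv.coe_coe] at h
    rw [h₁, h₃] at h
    rw [← h₄, h, h₅, ← hε.sliceLeft_T₁, hW]
    simp [mul_smul_comm, smul_mul_assoc]

theorem IsLeftInvariant.exists_isAntipode (hφ : H.IsLeftInvariant φ) (h0 : φ ≠ 0) :
    ∃ S : A →ₗ[ℂ] A, H.IsAntipode S := by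
  have : Nontrivial A := by
    obtain ⟨a, ha⟩ := exists_apply_eq_one h0
    exact nontrivial_of_ne a 0 fun h => by simp [h] at ha
  obtain ⟨ε, hε⟩ := H.exists_isCounit
  let F : A ⊗[ℂ] A →ₗ[ℂ] A := sliceRight φ ∘ₗ H.T₁.toLinearMap
  have hF : LinearMap.range F = ⊤ :=
    LinearMap.range_eq_top.2 ((sliceRight_surjective h0).comp H.T₁.surjective)
  -- Any linear section of F will do: by `sliceLeft_T₁_symm` the resulting S(x)e depends only on x
  -- and e.
  obtain ⟨g, hg⟩ := F.exists_rightInverse_of_surjective hF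
  refine ⟨sliceRight φ ∘ₗ H.T₄ ∘ₗ (TensorProduct.comm ℂ A A).toLinearMap ∘ₗ g,
    hε.isAntipode fun x e => ?_⟩
  have hX (X : A ⊗[ℂ] A) : sliceLeft ε (H.T₁.symm (F X ⊗ₜ[ℂ] e)) =
      sliceRight φ (H.T₄ (TensorProduct.comm ℂ A A X)) * e := by
    induction X with
    | zero => simp
    | add Y Y' h h' => simp only [map_add, TensorProduct.add_tmul, add_mul, h, h']
    | tmul u v => exact hφ.sliceLeft_T₁_symm hε u v e
  have hx : F (g x) = x := LinearMap.congr_fun hg x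
  simpa [hx] using (hX (g x)).symm

variable {S : A →ₗ[ℂ] A}

theorem IsAntipode.exists_counit (hS : H.IsAntipode S) : ∃ ε : A →ₗ[ℂ] ℂ, H.IsCounit ε ∧
    ∀ Z, LinearMap.mul' ℂ A (S.rTensor A (H.T₁ Z)) = sliceLeft ε Z := by
  obtain ⟨ε, hε, h⟩ := hS
  refine ⟨ε, hε, fun Z => ?_⟩
  induction Z with
  | zero => simp
  | add Y Y' h h' => simp only [map_add, h, h']
  | tmul u v => simp [h]

theorem IsAntipode.mul'_rTensor_T₁ (hS : H.IsAntipode S) (hε : H.IsCounit ε) (Z : A ⊗[ℂ] A) :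
    LinearMap.mul' ℂ A (S.rTensor A (H.T₁ Z)) = sliceLeft ε Z := by
  obtain ⟨ε', hε', h⟩ := hS.exists_counit
  rw [h, hε.unique hε']

theorem IsAntipode.mul_eq (hS : H.IsAntipode S) (hε : H.IsCounit ε) (x e : A) :
    S x * e = sliceLeft ε (H.T₁.symm (x ⊗ₜ[ℂ] e)) := by
  rw [← hS.mul'_rTensor_T₁ hε]
  simp

theorem IsAntipode.unique (hS : H.IsAntipode S) {S' : A →ₗ[ℂ] A} (hS' : H.IsAntipode S') :
    S = S' := by
  obtain ⟨ε, hε, -⟩ := hS.exists_counit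
  refine LinearMap.ext fun x => H.mul_right_ext fun e => ?_
  rw [hS.mul_eq hε, hS'.mul_eq hε]

/-- m(S⊗ι)(Δ(p)(y⊗q)) = ε(p)S(y)q = S(y)·m(S⊗ι)(Δ(p)(1⊗q)), and the elements Δ(p)(1⊗q) span A⊗A. -/
theorem IsAntipode.map_mul (hS : H.IsAntipode S) (x y : A) : S (x * y) = S y * S x := by
  obtain ⟨ε, hε, h⟩ := hS.exists_counit
  have h₁ (p : A) (X : A ⊗[ℂ] A) : LinearMap.mul' ℂ A (S.rTensor A (H.comulLeft p X)) =
      ε p • LinearMap.mul' ℂ A (S.rTensor A X) := by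
    obtain ⟨W, rfl⟩ := H.T₁.surjective X
    induction W with
    | zero => simp
    | add Y Y' h h' => simp only [map_add, smul_add, h, h']
    | tmul r t => rw [← T₁_mul_tmul, h, h]; simp [hε.map_mul, smul_smul]
  have h₂ (Z : A ⊗[ℂ] A) : LinearMap.mul' ℂ A (S.rTensor A ((tmulOne y).right (H.T₁ Z))) =
      S y * LinearMap.mul' ℂ A (S.rTensor A (H.T₁ Z)) := by
    induction Z with
    | zero => simp
    | add Y Y' h h' => simp only [map_add, mul_add, h, h']
    | tmul p q => rw [← comulLeft_tmul, h₁, h]; simp [mul_smul_comm]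
  refine H.mul_right_ext fun e => ?_
  have h₃ := h₂ (H.T₁.symm (x ⊗ₜ[ℂ] e))
  simpa [mul_assoc] using h₃

theorem IsAntipode.apply_sliceRight (hS : H.IsAntipode S) (hφ : H.IsLeftInvariant φ) (p q : A) :
    S (sliceRight φ (H.T₁ (p ⊗ₜ[ℂ] q))) = sliceRight φ (H.T₄ (q ⊗ₜ[ℂ] p)) := by
  obtain ⟨ε, hε, -⟩ := hS.exists_counit
  refine H.mul_right_ext fun e => ?_
  rw [hS.mul_eq hε, hφ.sliceLeft_T₁_symm hε]

theorem IsAntipode.apply_sliceRight' (hS : H.IsAntipode S) (hφ : H.IsLeftInvariant φ)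
    (X : A ⊗[ℂ] A) :
    S (sliceRight φ (H.T₁ X)) = sliceRight φ (H.T₄ (TensorProduct.comm ℂ A A X)) := by
  induction X with
  | zero => simp
  | add Y Y' h h' => simp only [_root_.map_add, h, h']
  | tmul u v => exact hS.apply_sliceRight hφ u v

theorem IsAntipode.surjective (hS : H.IsAntipode S) (hφ : H.IsLeftInvariant φ) (h0 : φ ≠ 0) :
    Function.Surjective S := fun x => by
  obtain ⟨Y, rfl⟩ := sliceRight_surjective h0 x
  obtain ⟨Z, rfl⟩ := H.T₄_surjective Y
  exact ⟨_, (hS.apply_sliceRight' hφ ((TensorProduct.comm ℂ A A).symm Z)).trans (by simp)⟩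

theorem IsAntipode.comp_ne_zero (hS : H.IsAntipode S) (hφ : H.IsLeftInvariant φ) (h0 : φ ≠ 0) :
    φ ∘ₗ S ≠ 0 := fun h => by
  obtain ⟨a, ha⟩ := exists_apply_eq_one h0
  obtain ⟨b, rfl⟩ := hS.surjective hφ h0 a
  have := LinearMap.congr_fun h b
  simp only [LinearMap.comp_apply, LinearMap.zero_apply] at this
  simp [this] at ha

/-- By the formula for S, φ∘S∘f is φ composed with a convolution, hence left invariant. Slicing
`T₁_comm` by φ∘S therefore gives the same value as slicing the inner tensor by φ∘S∘f. Since `T₃` is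
onto, that tensor may be replaced by b⊗s. -/
theorem IsAntipode.isRightInvariant (hS : H.IsAntipode S) (hφ : H.IsLeftInvariant φ)
    (h0 : φ ≠ 0) : H.IsRightInvariant (φ ∘ₗ S) := by
  have key (p q e : A) (f : A →ₗ[ℂ] A) (hf : ∀ s, f s = sliceRight φ (H.T₁ (p ⊗ₜ[ℂ] s))) :
      sliceLeft (φ ∘ₗ S) (H.T₁ (TensorProduct.comm ℂ A A (f.lTensor A (H.T₃ (e ⊗ₜ[ℂ] q))))) =
        sliceRight (φ ∘ₗ S ∘ₗ f) (H.T₃ (e ⊗ₜ[ℂ] q)) := by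
    have hg : φ ∘ₗ S ∘ₗ f = φ ∘ₗ H.convRight' φ p := by
      ext s
      simp [hf, hS.apply_sliceRight hφ, convRight'_apply]
    rw [hφ.T₁_comm p q e f hf, hg, hφ.comp_convRight', ← hg]
    simp
  intro a b
  obtain ⟨Y, rfl⟩ := sliceRight_surjective h0 a
  obtain ⟨Z, rfl⟩ := H.T₁.surjective Y
  induction Z with
  | zero => simp
  | add Y Y' h h' => simp only [_root_.map_add, TensorProduct.add_tmul, add_smul, h, h']
  | tmul p s =>
    let f : A →ₗ[ℂ] A := sliceRight φ ∘ₗ H.T₁.toLinearMap ∘ₗ TensorProduct.mk ℂ A A p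
    have key' (X : A ⊗[ℂ] A) :
        sliceLeft (φ ∘ₗ S) (H.T₁ (TensorProduct.comm ℂ A A (f.lTensor A X))) =
          sliceRight (φ ∘ₗ S ∘ₗ f) X := by
      obtain ⟨W, rfl⟩ := H.T₃_surjective X
      induction W with
      | zero => simp
      | add Y Y' h h' => simp only [_root_.map_add, h, h']
      | tmul e q => exact key p q e f fun s => rfl
    simpa [f] using key' (b ⊗ₜ[ℂ] s)

end Antipode

end


section

variable {A : Type*} [NonUnitalRing A] [StarRing A] [Module ℂ A]
    [IsScalarTower ℂ A A] [SMulCommClass ℂ A A] [StarModule ℂ A]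
    {H : MultiplierHopfStarAlgebra A}

/-! ### Uniqueness of left invariant functionals -/

section Uniqueness

variable {φ θ ψ : A →ₗ[ℂ] ℂ}

/-- This evaluates ψ⊗θ on Δ(p)T₁(Y) by invariance of ψ; its companion evaluates ψ⊗φ on Δ(p)T₃(Y) by
invariance of φ. As `T₁` and `T₃` are onto, functionals ψ(·c) and φ(·c') can be exchanged. -/
theorem IsRightInvariant.apply_comulLeft_T₁ (hψ : H.IsRightInvariant ψ) (θ : A →ₗ[ℂ] ℂ) (p : A)
    (Y : A ⊗[ℂ] A) : θ (sliceLeft ψ (H.comulLeft p (H.T₁ Y))) = ψ (p * sliceRight θ Y) := by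
  induction Y with
  | zero => simp
  | add Y Y' h h' => simp only [map_add, mul_add, h, h']
  | tmul n m => rw [← T₁_mul_tmul, hψ]; simp [mul_smul_comm, mul_comm]

theorem IsLeftInvariant.apply_comulLeft_T₃ (hφ : H.IsLeftInvariant φ) (ψ : A →ₗ[ℂ] ℂ) (p : A)
    (Y : A ⊗[ℂ] A) : φ (sliceLeft ψ (H.comulLeft p (H.T₃ Y))) = φ (p * sliceLeft ψ Y) := by
  induction Y with
  | zero => simp
  | add Y Y' h h' => simp only [map_add, mul_add, h, h']
  | tmul n m => rw [← T₃_tmul_mul, apply_sliceLeft, hφ]; simp [mul_smul_comm, mul_comm]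

/-- After left multiplication by (b⊗1)Δ(p), invariance turns the slices into bθ(pa)c and bφ(pa')c;
the elements (b⊗1)Δ(p) span A⊗A. -/
theorem IsLeftInvariant.sliceRight_T₃_congr (hφ : H.IsLeftInvariant φ) (hθ : H.IsLeftInvariant θ)
    {a a' : A} (h : ∀ p, θ (p * a) = φ (p * a')) (c e : A) :
    sliceRight (θ ∘ₗ LinearMap.mulLeft ℂ e) (H.T₃ (c ⊗ₜ[ℂ] a)) =
      sliceRight (φ ∘ₗ LinearMap.mulLeft ℂ e) (H.T₃ (c ⊗ₜ[ℂ] a')) := by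
  have h₁ (W : A ⊗[ℂ] A) : sliceRight θ (W * H.T₃ (c ⊗ₜ[ℂ] a)) =
      sliceRight φ (W * H.T₃ (c ⊗ₜ[ℂ] a')) := by
    obtain ⟨Z, rfl⟩ := H.T₂.surjective W
    induction Z with
    | zero => simp
    | add Y Y' h h' => simp only [map_add, add_mul, h, h']
    | tmul b p =>
      rw [← left_tmulOne_comulLeft, ← left_tmulOne_comulLeft, sliceRight_left_tmulOne,
        sliceRight_left_tmulOne, ← T₃_tmul_mul, ← T₃_tmul_mul, hφ, hθ, h]
  refine H.mul_left_ext fun x => ?_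
  have h₂ := h₁ (x ⊗ₜ e)
  rwa [tmul_mul, tmul_mul, sliceRight_left_oneTmul, sliceRight_left_oneTmul,
    sliceRight_left_tmulOne, sliceRight_left_tmulOne] at h₂

theorem IsLeftInvariant.sliceRight_T₄_congr (hφ : H.IsLeftInvariant φ) (hθ : H.IsLeftInvariant θ)
    {a a' : A} (h : ∀ p, θ (p * a) = φ (p * a')) (y : A) :
    sliceRight θ (H.T₄ (a ⊗ₜ[ℂ] y)) = sliceRight φ (H.T₄ (a' ⊗ₜ[ℂ] y)) :=
  H.mul_right_ext fun c => by
    rw [← sliceRight_right_tmulOne, ← sliceRight_right_tmulOne, right_tmulOne_T₄,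
      right_tmulOne_T₄, sliceRight_left_oneTmul, sliceRight_left_oneTmul,
      hφ.sliceRight_T₃_congr hθ h]

/-- Left invariant functionals are unique up to a scalar. -/
theorem IsLeftInvariant.exists_eq_smul (hφ : H.IsLeftInvariant φ) (h0 : φ ≠ 0)
    (hψ : H.IsRightInvariant ψ) (hψ0 : ψ ≠ 0) (hθ : H.IsLeftInvariant θ) :
    ∃ k : ℂ, ∀ x, θ x = k * φ x := by
  obtain ⟨b, hb⟩ := exists_apply_eq_one hψ0
  obtain ⟨m, hm⟩ := exists_apply_eq_one h0
  -- Since ψ(b) = 1, θ(pb) is the value of ψ⊗θ on Δ(p)T₃(b⊗b). Writing that tensor as T₁Y turns the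
  -- value into ψ(pc); then φ(m) = 1 and T₁(c⊗m) = T₃Y' turn it into φ(pb').
  obtain ⟨Y, hY⟩ := H.T₁.surjective (H.T₃ (b ⊗ₜ[ℂ] b))
  obtain ⟨Y', hY'⟩ := H.T₃_surjective (H.T₁ (sliceRight θ Y ⊗ₜ[ℂ] m))
  have key (p : A) : θ (p * b) = φ (p * sliceLeft ψ Y') := by
    have h₁ := hθ.apply_comulLeft_T₃ ψ p (b ⊗ₜ[ℂ] b)
    have h₂ := hψ.apply_comulLeft_T₁ φ p (sliceRight θ Y ⊗ₜ[ℂ] m)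
    rw [← hY, hψ.apply_comulLeft_T₁] at h₁
    rw [← hY', hφ.apply_comulLeft_T₃] at h₂
    simp only [sliceLeft_tmul, hb, one_smul] at h₁
    simp only [sliceRight_tmul, hm, one_smul] at h₂
    rw [← h₁, h₂]
  refine ⟨ψ (sliceLeft ψ Y'), fun x => ?_⟩
  have h := congrArg ψ (hφ.sliceRight_T₄_congr hθ key x)
  rw [← apply_sliceLeft, ← apply_sliceLeft, hψ.sliceLeft_T₄, hψ.sliceLeft_T₄] at h
  simpa [hb] using h

end Uniqueness

/-! ### Faithfulness of left invariant functionals -/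

section Faithful

variable {φ ε : A →ₗ[ℂ] ℂ} {S : A →ₗ[ℂ] A}

/-- Formally ω(ap₁)S(p₂f)p₃q = S(f)ω(ap)q. The left side has the shape m(κ⊗ι) needed for
`apply_mul'_rTensor_eq_zero`. -/
theorem IsAntipode.mul'_convLeft_T₁ (hS : H.IsAntipode S) (ω : A →ₗ[ℂ] ℂ) (a f : A)
    (Z : A ⊗[ℂ] A) :
    LinearMap.mul' ℂ A ((S ∘ₗ LinearMap.mulRight ℂ f ∘ₗ H.convLeft ω a).rTensor A (H.T₁ Z)) =
      S f * sliceLeft (ω ∘ₗ LinearMap.mulLeft ℂ a) Z := by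
  obtain ⟨ε, hε, h⟩ := hS.exists_counit
  have hX (X : A ⊗[ℂ] A) :
      LinearMap.mul' ℂ A ((S ∘ₗ LinearMap.mulRight ℂ f ∘ₗ H.convLeft ω a).rTensor A X) =
        S f * LinearMap.mul' ℂ A (S.rTensor A ((H.convLeft ω a).rTensor A X)) := by
    induction X with
    | zero => simp
    | add Y Y' h h' => simp only [_root_.map_add, mul_add, h, h']
    | tmul u v => simp [hS.map_mul, mul_assoc]
  induction Z with
  | zero => simp
  | add Y Y' h h' => simp only [_root_.map_add, mul_add, h, h']
  | tmul p q =>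
    have hp : ε (H.convLeft ω a p) = ω (a * p) := by
      rw [convLeft_apply, apply_sliceLeft, hε.sliceRight_T₂, LinearMap.mul'_apply]
    rw [hX, ← T₁_convLeft_tmul, h, sliceLeft_tmul, hp]
    simp

/-- Formally T₁⁻¹(a₁d⊗a₂) = ad₁⊗S(d₂), so both sides are ω(bad₁)S(d₂f). -/
theorem IsAntipode.mul_sliceLeft_T₁_symm (hS : H.IsAntipode S) (ω : A →ₗ[ℂ] ℂ) (a b d f : A) :
    S f * sliceLeft (ω ∘ₗ LinearMap.mulLeft ℂ b) (H.T₁.symm (H.T₃ (d ⊗ₜ[ℂ] a))) =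
      S (sliceLeft (ω ∘ₗ LinearMap.mulLeft ℂ (b * a)) (H.T₁ (d ⊗ₜ[ℂ] f))) := by
  refine H.mul_right_ext fun g => ?_
  have h₁ (Z : A ⊗[ℂ] A) : H.T₁ ((oneTmul g).right Z) = (oneTmul g).right (H.T₁ Z) := by
    induction Z with
    | zero => simp
    | add Y Y' h h' => simp only [_root_.map_add, h, h']
    | tmul u v => rw [right_oneTmul_T₁, right_oneTmul]
  have h₂ (Z : A ⊗[ℂ] A) : H.T₁ ((tmulOne a).left Z) = H.comulLeft a (H.T₁ Z) := by
    induction Z with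
    | zero => simp
    | add Y Y' h h' => simp only [_root_.map_add, h, h']
    | tmul u v => rw [left_tmulOne, T₁_mul_tmul]
  have h₃ : (oneTmul g).right (H.T₁.symm (H.T₃ (d ⊗ₜ[ℂ] a))) =
      (tmulOne a).left (H.T₁.symm (d ⊗ₜ[ℂ] g)) := by
    apply H.T₁.injective
    rw [h₁, h₂, LinearEquiv.apply_symm_apply, LinearEquiv.apply_symm_apply, comulLeft_tmul']
  have h₄ := hS.mul'_convLeft_T₁ ω (b * a) f (H.T₁.symm (d ⊗ₜ[ℂ] g))
  rw [LinearEquiv.apply_symm_apply] at h₄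
  rw [mul_assoc, ← sliceLeft_right_oneTmul, h₃, sliceLeft_left_tmulOne, LinearMap.comp_assoc,
    ← LinearMap.mulLeft_mul, ← h₄, ← sliceLeft_left_tmulOne ω, ← right_oneTmul_T₂,
    sliceLeft_right_oneTmul, ← convLeft_apply]
  simp

/-- Left integrals are faithful. -/
theorem IsAntipode.faithful (hS : H.IsAntipode S) (hφ : H.IsLeftInvariant φ) (h0 : φ ≠ 0) {a : A}
    (ha : ∀ p, φ (p * a) = 0) : a = 0 := by
  have h₁ (d e : A) : sliceRight (φ ∘ₗ LinearMap.mulLeft ℂ e) (H.T₃ (d ⊗ₜ[ℂ] a)) = 0 := by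
    rw [hφ.sliceRight_T₃_congr hφ (a' := 0) (by simpa using ha)]
    simp
  obtain ⟨y, hy⟩ := exists_apply_eq_one (hS.comp_ne_zero hφ h0)
  refine H.eq_zero_of_mul_right a fun x => H.eq_zero_of_mul_left _ fun b =>
    functional_ext fun ω => ?_
  have h₂ (X : A ⊗[ℂ] A) : φ (S (sliceLeft (ω ∘ₗ LinearMap.mulLeft ℂ (b * a)) X)) = 0 := by
    obtain ⟨Z, rfl⟩ := H.T₁.surjective X
    induction Z with
    | zero => simp
    | add Y Y' h h' => simp only [_root_.map_add, h, h', add_zero]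
    | tmul d f =>
      rw [← hS.mul_sliceLeft_T₁_symm, ← hS.mul'_convLeft_T₁, LinearEquiv.apply_symm_apply]
      exact apply_mul'_rTensor_eq_zero φ (h₁ d) _
  have h₃ := h₂ (x ⊗ₜ y)
  simp only [LinearMap.comp_apply] at hy
  simpa [hy, mul_assoc] using h₃

end Faithful

/-! ### The modular element -/

section Modular

/-- A positive left integral `φ` with counit `ε`, antipode `S` and left multiplication `L` by the
modular element `δ`, which is characterized by `(φ ⊗ ι)Δ(a) = φ(a)δ`. -/
structure ModularData (H : MultiplierHopfStarAlgebra A) (φ ε : A →ₗ[ℂ] ℂ) (S L : A →ₗ[ℂ] A) :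
    Prop where
  left_inv : H.IsLeftInvariant φ
  ne_zero : φ ≠ 0
  pos : IsPositiveFunctional φ
  counit : H.IsCounit ε
  antipode : H.IsAntipode S
  sliceLeft_T₁ : ∀ a b, sliceLeft φ (H.T₁ (a ⊗ₜ[ℂ] b)) = φ a • L b

variable {φ ε : A →ₗ[ℂ] ℂ} {S L : A →ₗ[ℂ] A}

/-- Each φ∘(ι⊗ω)(Δ(·)(1⊗b)) is left invariant, hence a multiple of φ. So (φ⊗ι)(Δ(a)(1⊗b)) is φ(a)
times a vector independent of a, read off at φ(p) = 1. -/
theorem IsAntipode.exists_modularData (hS : H.IsAntipode S) (hφ : H.IsLeftInvariant φ)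
    (h0 : φ ≠ 0) (hpos : IsPositiveFunctional φ) : ∃ ε L, H.ModularData φ ε S L := by
  obtain ⟨ε, hε, -⟩ := hS.exists_counit
  obtain ⟨p, hp⟩ := exists_apply_eq_one h0
  refine ⟨ε, sliceLeft φ ∘ₗ H.T₁.toLinearMap ∘ₗ TensorProduct.mk ℂ A A p, hφ, h0, hpos, hε, hS,
    fun a b => functional_ext fun ω => ?_⟩
  obtain ⟨k, hk⟩ := hφ.exists_eq_smul h0 (hS.isRightInvariant hφ h0) (hS.comp_ne_zero hφ h0)
    (hφ.comp_convRight ω b)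
  have hk' (x : A) : ω (sliceLeft φ (H.T₁ (x ⊗ₜ[ℂ] b))) = k * φ x := by
    rw [apply_sliceLeft, ← hk]; rfl
  simp [hk', hp, mul_comm]

theorem IsPositiveFunctional.apply_star_mul {ω : A →ₗ[ℂ] ℂ} (h : IsPositiveFunctional ω)
    (x y : A) : ω (star y * x) = star (ω (star x * y)) := by
  have h₁ := (Complex.nonneg_iff.1 (h x)).2
  have h₂ := (Complex.nonneg_iff.1 (h y)).2
  have h₃ := (Complex.nonneg_iff.1 (h (x + y))).2
  have h₄ := (Complex.nonneg_iff.1 (h (x + Complex.I • y))).2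
  simp only [star_add, add_mul, mul_add, map_add, star_smul, smul_mul_assoc, mul_smul_comm,
    map_smul, smul_eq_mul, Complex.add_im, Complex.mul_im, RCLike.star_def, Complex.conj_I,
    Complex.I_re, Complex.I_im, Complex.neg_re, Complex.neg_im, Complex.mul_re] at h₃ h₄
  apply Complex.ext
  · simp only [RCLike.star_def, Complex.conj_re]; linarith
  · simp only [RCLike.star_def, Complex.conj_im]; linarith

namespace ModularData

variable (D : H.ModularData φ ε S L)

include D

theorem nontrivial : Nontrivial A := by
  obtain ⟨a, ha⟩ := exists_apply_eq_one D.ne_zero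
  exact nontrivial_of_ne a 0 fun h => by simp [h] at ha

/-- m = (ε⊗ι)T₁ with ε ≠ 0 and `T₁` onto. It extends hermitian symmetry of φ from products to all of
A. -/
theorem exists_mul' (x : A) : ∃ Z, LinearMap.mul' ℂ A Z = x := by
  have := D.nontrivial
  obtain ⟨e, he⟩ := exists_apply_eq_one D.counit.ne_zero
  obtain ⟨Z, hZ⟩ := H.T₁.surjective (e ⊗ₜ[ℂ] x)
  exact ⟨Z, by rw [← D.counit.sliceLeft_T₁, hZ]; simp [he]⟩

theorem apply_star (x : A) : φ (star x) = star (φ x) := by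
  obtain ⟨Z, rfl⟩ := D.exists_mul' x
  induction Z with
  | zero => simp
  | add Y Y' h h' => simp only [map_add, star_add, h, h']
  | tmul u v => simpa using IsPositiveFunctional.apply_star_mul D.pos (star u) v

theorem starFunctional_eq : starFunctional φ = φ :=
  LinearMap.ext fun x => by rw [starFunctional_apply, D.apply_star, star_star]

theorem sliceLeft_T₄ (a b : A) :
    sliceLeft φ (H.T₄ (a ⊗ₜ[ℂ] b)) = φ a • MultiplierAlg.conjMap L b := by
  rw [T₄_apply, sliceLeft_star, D.starFunctional_eq, TensorProduct.star_tmul, D.sliceLeft_T₁,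
    D.apply_star, star_smul, star_star]
  rfl

/-- Both sides slice (1⊗b)Δ(a)(1⊗c) by φ. Thus δ is a selfadjoint multiplier with right action
`conjMap L`. -/
theorem conjMap_mul (b c : A) : MultiplierAlg.conjMap L b * c = b * L c := by
  obtain ⟨a, ha⟩ := exists_apply_eq_one D.ne_zero
  have h := D.sliceLeft_T₄ a b
  have h' := D.sliceLeft_T₁ a c
  rw [ha, one_smul] at h h'
  rw [← h, ← h', ← sliceLeft_right_oneTmul, right_oneTmul_T₄, sliceLeft_left_oneTmul]

theorem map_mul (b c : A) : L (b * c) = L b * c :=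
  H.mul_left_ext fun d => by
    rw [← D.conjMap_mul, ← mul_assoc, ← mul_assoc, D.conjMap_mul]

theorem conjMap_map_mul (b c : A) :
    MultiplierAlg.conjMap L (b * c) = b * MultiplierAlg.conjMap L c :=
  H.mul_right_ext fun d => by
    rw [D.conjMap_mul, mul_assoc, mul_assoc, D.conjMap_mul]

/-- `Δ(δ a) = (δ ⊗ δ)Δ(a)`. -/
theorem T₁_map_tmul (a b : A) :
    H.T₁ (L a ⊗ₜ[ℂ] b) = TensorProduct.map L L (H.T₁ (a ⊗ₜ[ℂ] b)) := by
  refine sliceRight_ext fun ω => ?_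
  obtain ⟨p, hp⟩ := exists_apply_eq_one D.ne_zero
  let f : A →ₗ[ℂ] A := sliceRight ω ∘ₗ H.T₁.toLinearMap ∘ₗ TensorProduct.mk ℂ A A p
  have hf (s : A) : f s = sliceRight ω (H.T₁ (p ⊗ₜ[ℂ] s)) := rfl
  -- Both sides are p₁ ⊗ p₂a₁ω(p₃a₂b); slicing the first leg by φ then produces δ in two places.
  have h₁ : H.T₁ (TensorProduct.comm ℂ A A (f.lTensor A (H.T₁ (a ⊗ₜ[ℂ] b)))) =
      (H.convRight ω b).lTensor A (H.T₁ (p ⊗ₜ[ℂ] a)) := by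
    refine H.left_tmulOne_ext fun c => ?_
    rw [left_tmulOne_T₁_comm H ω c p f hf, left_tmulOne_lTensor, ← right_oneTmul_T₂]
    generalize H.T₂ (c ⊗ₜ[ℂ] p) = Y
    induction Y with
    | zero => simp
    | add Y Y' h h' => simp only [_root_.map_add, h, h']
    | tmul u v => simp [convRight_apply, T₁_mul_tmul]
  have h₂ (X : A ⊗[ℂ] A) : sliceLeft φ (H.T₁ (TensorProduct.comm ℂ A A (f.lTensor A X))) =
      L (sliceRight (ω ∘ₗ L) X) := by
    induction X with
    | zero => simp
    | add Y Y' h h' => simp only [_root_.map_add, h, h']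
    | tmul r s =>
      have hs : φ (f s) = ω (L s) := by
        rw [hf, ← apply_sliceLeft, D.sliceLeft_T₁, hp, one_smul]
      simp [D.sliceLeft_T₁, hs]
  rw [sliceRight_map, ← h₂, h₁, sliceLeft_lTensor, D.sliceLeft_T₁, hp, one_smul, convRight_apply]

theorem counit_map (x : A) : ε (L x) = ε x := by
  obtain ⟨p, hp⟩ := exists_apply_eq_one D.ne_zero
  have h : sliceRight ε (H.T₁ (p ⊗ₜ[ℂ] x)) = ε x • p := by
    refine H.mul_left_ext fun a => ?_
    have hx : ε ∘ₗ LinearMap.mulRight ℂ x = ε x • ε := by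
      ext y
      simp [D.counit.map_mul, mul_comm]
    have hs (X : A ⊗[ℂ] A) : sliceRight (ε x • ε) X = ε x • sliceRight ε X := by
      simp [sliceRight]
    rw [← sliceRight_left_tmulOne, ← right_oneTmul_T₂, sliceRight_right_oneTmul, hx, hs,
      D.counit.sliceRight_T₂]
    simp [mul_smul_comm]
  have h' := apply_sliceLeft ε φ (H.T₁ (p ⊗ₜ[ℂ] x))
  rw [D.sliceLeft_T₁, h] at h'
  simpa [hp] using h'

/-- This is S(δ) = δ⁻¹: apply m(S⊗ι) to (δ⊗δ)Δ and use ε(δx) = ε(x). As S is onto, it makes δ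
invertible. -/
theorem conjMap_antipode_map (x : A) : MultiplierAlg.conjMap L (S (L x)) = S x := by
  have h₁ (Z : A ⊗[ℂ] A) : TensorProduct.map L L (H.T₁ Z) = H.T₁ (L.rTensor A Z) := by
    induction Z with
    | zero => simp
    | add Y Y' h h' => simp only [_root_.map_add, h, h']
    | tmul r s => rw [← D.T₁_map_tmul, LinearMap.rTensor_tmul]
  have h₂ : ε ∘ₗ L = ε := LinearMap.ext D.counit_map
  refine H.mul_right_ext fun y => ?_
  obtain ⟨Z, hZ⟩ := H.T₁.surjective (x ⊗ₜ[ℂ] y)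
  have h₃ := D.antipode.mul'_rTensor_T₁ D.counit (L.rTensor A Z)
  rw [← h₁, sliceLeft_rTensor, h₂, ← D.antipode.mul'_rTensor_T₁ D.counit, hZ] at h₃
  simpa [D.conjMap_mul] using h₃

theorem conjMap_surjective : Function.Surjective (MultiplierAlg.conjMap L) := fun x => by
  obtain ⟨y, rfl⟩ := D.antipode.surjective D.left_inv D.ne_zero x
  exact ⟨_, D.conjMap_antipode_map y⟩

theorem map_surjective : Function.Surjective L := fun x => by
  obtain ⟨y, hy⟩ := D.conjMap_surjective (star x)
  exact ⟨star y, star_injective hy⟩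

theorem map_injective : Function.Injective L :=
  (injective_iff_map_eq_zero L).2 fun x hx => H.eq_zero_of_mul_left x fun b => by
    obtain ⟨c, rfl⟩ := D.conjMap_surjective b
    rw [D.conjMap_mul, hx, mul_zero]

theorem conjMap_injective : Function.Injective (MultiplierAlg.conjMap L) := fun _ _ h =>
  star_injective (D.map_injective (star_injective h))

/-- Evaluate φ∘S ⊗ φ on Δ(x)(1⊗q) twice: by right invariance of φ∘S, and by the formula for S
followed by (φ⊗ι)((1⊗x)Δ(q)) = φ(q)xδ. -/
theorem apply_antipode (x : A) : φ (S x) = φ (MultiplierAlg.conjMap L x) := by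
  obtain ⟨q, hq⟩ := exists_apply_eq_one D.ne_zero
  have h₁ := apply_sliceLeft φ (φ ∘ₗ S) (H.T₁ (x ⊗ₜ[ℂ] q))
  rw [D.antipode.isRightInvariant D.left_inv D.ne_zero, LinearMap.comp_apply,
    LinearMap.comp_apply, D.antipode.apply_sliceRight D.left_inv, ← apply_sliceLeft,
    D.sliceLeft_T₄] at h₁
  simpa [hq] using h₁

end ModularData

end Modular

end


section

/-! ### Hermitian forms, finite-dimensional spectral theory and slices -/

section InnerProduct

variable {V : Type*} [AddCommGroup V] [Module ℂ V]

theorem mem_span_eigenvectors [FiniteDimensional ℂ V] (c : InnerProductSpace.Core ℂ V)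
    (T : V →ₗ[ℂ] V) (hT : ∀ x y, c.inner (T x) y = c.inner x (T y)) (v : V) :
    v ∈ Submodule.span ℂ {e | ∃ μ : ℂ, T e = μ • e} := by
  let _ : NormedAddCommGroup V := c.toNormedAddCommGroup
  let _ : InnerProductSpace ℂ V := InnerProductSpace.ofCore c.toCore
  have hs : T.IsSymmetric := hT
  have h := hs.orthogonalComplement_iSup_eigenspaces_eq_bot
  rw [Submodule.orthogonal_eq_bot_iff] at h
  have hv : v ∈ ⨆ μ, Module.End.eigenspace T μ := h ▸ Submodule.mem_top
  have hle : ⨆ μ, Module.End.eigenspace T μ ≤ Submodule.span ℂ {e | ∃ μ : ℂ, T e = μ • e} :=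
    iSup_le fun μ x hx => Submodule.subset_span ⟨μ, Module.End.mem_eigenspace_iff.1 hx⟩
  exact hle hv

/-- The double sum is the squared norm of ∑ u_i⊗v_i in the tensor product inner product space. -/
theorem sum_inner_mul_inner_nonneg {E : Type*} [NormedAddCommGroup E] [InnerProductSpace ℂ E]
    {ι : Type*} (s : Finset ι) (u v : ι → E) :
    0 ≤ ∑ i ∈ s, ∑ j ∈ s, inner ℂ (u i) (u j) * inner ℂ (v i) (v j) := by
  have h : (0 : ℂ) ≤ (‖∑ i ∈ s, u i ⊗ₜ[ℂ] v i‖ : ℂ) ^ 2 := by positivity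
  have h' := inner_self_eq_norm_sq_to_K (𝕜 := ℂ) (∑ i ∈ s, u i ⊗ₜ[ℂ] v i)
  replace h := h.trans_eq h'.symm
  rw [Finset.sum_comm]
  simpa only [sum_inner, inner_sum, TensorProduct.inner_tmul] using h

theorem tensor_inner_nonneg (c : InnerProductSpace.Core ℂ V) {ι : Type*} (s : Finset ι)
    (u v : ι → V) : 0 ≤ ∑ i ∈ s, ∑ j ∈ s, c.inner (u i) (u j) * c.inner (v i) (v j) := by
  let _ : NormedAddCommGroup V := c.toNormedAddCommGroup
  let _ : InnerProductSpace ℂ V := InnerProductSpace.ofCore c.toCore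
  exact sum_inner_mul_inner_nonneg s u v

end InnerProduct

variable {A : Type*} [NonUnitalRing A] [StarRing A] [Module ℂ A]
    [IsScalarTower ℂ A A] [SMulCommClass ℂ A A] [StarModule ℂ A]
    {H : MultiplierHopfStarAlgebra A} {φ ε : A →ₗ[ℂ] ℂ} {S L : A →ₗ[ℂ] A}

/-- The sesquilinear form `φ (x* y)` of a positive functional. -/
abbrev IsPositiveFunctional.preCore (hφ : IsPositiveFunctional φ) :
    PreInnerProductSpace.Core ℂ A where
  inner x y := φ (star x * y)
  conj_inner_symm x y := (IsPositiveFunctional.apply_star_mul hφ y x).symm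
  re_inner_nonneg x := (Complex.nonneg_iff.1 (hφ x)).1
  add_left x y z := by simp [add_mul]
  smul_left x y r := by simp [smul_mul_assoc]

theorem exists_finiteDimensional_sliceLeft_mem (X : A ⊗[ℂ] A) :
    ∃ W : Submodule ℂ A, FiniteDimensional ℂ W ∧ ∀ ω, sliceLeft ω X ∈ W := by
  induction X with
  | zero => exact ⟨⊥, inferInstance, fun ω => by simp⟩
  | tmul x y =>
    exact ⟨Submodule.span ℂ {y}, inferInstance, fun ω => by
      simpa using Submodule.smul_mem _ _ (Submodule.mem_span_singleton_self y)⟩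
  | add X Y hX hY =>
    obtain ⟨W, hW, h⟩ := hX
    obtain ⟨W', hW', h'⟩ := hY
    exact ⟨W ⊔ W', inferInstance, fun ω => by
      rw [map_add]
      exact Submodule.add_mem_sup (h ω) (h' ω)⟩

/-! ### Positivity of δ and local finiteness of its action -/

namespace ModularData

variable (D : H.ModularData φ ε S L)

include D

theorem comulLeft_map (a : A) (X : A ⊗[ℂ] A) :
    H.comulLeft (L a) X = TensorProduct.map L L (H.comulLeft a X) := by
  have h₁ (x : A) (X : A ⊗[ℂ] A) : (tmulOne x).right (TensorProduct.map L L X) =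
      TensorProduct.map L L ((tmulOne x).right X) := by
    induction X with
    | zero => simp
    | add Y Y' h h' => simp only [_root_.map_add, h, h']
    | tmul u v => simp [D.map_mul]
  induction X with
  | zero => simp
  | add Y Y' h h' => simp only [_root_.map_add, h, h']
  | tmul x y => rw [comulLeft_tmul, comulLeft_tmul, D.T₁_map_tmul, h₁]

theorem map_conjMap_mul (X Y : A ⊗[ℂ] A) :
    TensorProduct.map (MultiplierAlg.conjMap L) (MultiplierAlg.conjMap L) X * Y =
      X * TensorProduct.map L L Y := by
  induction X with
  | zero => simp
  | add X X' h h' => simp only [_root_.map_add, add_mul, h, h']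
  | tmul x x' =>
    induction Y with
    | zero => simp
    | add X X' h h' => simp only [_root_.map_add, mul_add, h, h']
    | tmul y y' => simp [D.conjMap_mul]

/-- `Δ(a δ) = Δ(a)(δ ⊗ δ)`. -/
theorem comulLeft_conjMap (a : A) (X : A ⊗[ℂ] A) :
    H.comulLeft (MultiplierAlg.conjMap L a) X = H.comulLeft a (TensorProduct.map L L X) := by
  have h₁ (X : A ⊗[ℂ] A) : star (TensorProduct.map L L (star X)) =
      TensorProduct.map (MultiplierAlg.conjMap L) (MultiplierAlg.conjMap L) X := by
    induction X with
    | zero => simp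
    | add X X' h h' => simp only [_root_.map_add, star_add, h, h']
    | tmul x x' => rfl
  have h₂ (b : A) (Y : A ⊗[ℂ] A) : (H.comul b).right Y = star (H.comulLeft (star b) (star Y)) := by
    rw [comulLeft_apply, ← MultiplierAlg.star_right, ← map_star, star_star]
  refine H.tensor_mul_left_ext fun Y => ?_
  rw [comulLeft_apply, comulLeft_apply, ← MultiplierAlg.right_mul_eq, ← MultiplierAlg.right_mul_eq,
    ← D.map_conjMap_mul, h₂, h₂, ← h₁, star_star, ← D.comulLeft_map]
  change star (H.comulLeft (star (star (L (star a)))) _) * X = _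
  rw [star_star]

theorem T₁_conjMap_tmul (a q : A) : H.T₁ (MultiplierAlg.conjMap L a ⊗ₜ[ℂ] q) =
    (MultiplierAlg.conjMap L).rTensor A (H.T₁ (a ⊗ₜ[ℂ] L q)) := by
  refine H.right_tmulOne_ext fun x => ?_
  rw [← comulLeft_tmul, D.comulLeft_conjMap, TensorProduct.map_tmul, comulLeft_tmul]
  generalize H.T₁ (a ⊗ₜ[ℂ] L q) = X
  induction X with
  | zero => simp
  | add X X' h h' => simp only [_root_.map_add, h, h']
  | tmul u v => simp [D.conjMap_mul]

theorem T₃_tmul_conjMap (a b : A) : H.T₃ (b ⊗ₜ[ℂ] MultiplierAlg.conjMap L a) =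
    (MultiplierAlg.conjMap L).lTensor A (H.T₃ (L b ⊗ₜ[ℂ] a)) := by
  refine H.right_oneTmul_ext fun x => ?_
  rw [← comulLeft_tmul', D.comulLeft_conjMap, TensorProduct.map_tmul, comulLeft_tmul']
  generalize H.T₃ (L b ⊗ₜ[ℂ] a) = X
  induction X with
  | zero => simp
  | add X X' h h' => simp only [_root_.map_add, h, h']
  | tmul u v => simp [D.conjMap_mul]

theorem T₃_tmul_map (a b : A) : H.T₃ (b ⊗ₜ[ℂ] L a) =
    TensorProduct.map L L (H.T₃ (b ⊗ₜ[ℂ] a)) := by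
  refine H.right_oneTmul_ext fun x => ?_
  rw [← comulLeft_tmul', D.comulLeft_map, comulLeft_tmul']
  generalize H.T₃ (b ⊗ₜ[ℂ] a) = X
  induction X with
  | zero => simp
  | add X X' h h' => simp only [_root_.map_add, h, h']
  | tmul u v => simp [D.map_mul]

/-- As δ is group-like, x ↦ φ(δxδ⁻¹) is left invariant, hence a multiple of φ. -/
theorem exists_apply_map_eq :
    ∃ c : ℂ, ∀ x, φ (L x) = c * φ (MultiplierAlg.conjMap L x) := by
  let R : A ≃ₗ[ℂ] A := LinearEquiv.ofBijective (MultiplierAlg.conjMap L)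
    ⟨D.conjMap_injective, D.conjMap_surjective⟩
  have hR (x : A) : R x = MultiplierAlg.conjMap L x := rfl
  let θ : A →ₗ[ℂ] ℂ := φ ∘ₗ L ∘ₗ R.symm.toLinearMap
  have hθR (x : A) : θ (MultiplierAlg.conjMap L x) = φ (L x) := by
    rw [← hR]; simp [θ]
  have hθ : H.IsLeftInvariant θ := fun a b => by
    obtain ⟨a, rfl⟩ := D.conjMap_surjective a
    have h : θ ∘ₗ MultiplierAlg.conjMap L = φ ∘ₗ L := LinearMap.ext hθR
    -- The extra δ on the first leg completes δ⊗δ, so that Δ(δa) appears.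
    apply D.map_injective
    rw [D.T₃_tmul_conjMap, sliceRight_lTensor, h, ← sliceRight_map, ← D.T₃_tmul_map, D.left_inv,
      hθR, map_smul]
  obtain ⟨c, hc⟩ := D.left_inv.exists_eq_smul D.ne_zero
    (D.antipode.isRightInvariant D.left_inv D.ne_zero)
    (D.antipode.comp_ne_zero D.left_inv D.ne_zero) hθ
  exact ⟨c, fun x => by rw [← hc, hθR]⟩

/-- Cauchy–Schwarz gives φ(px) = 0 for all p, and φ is faithful. -/
theorem eq_zero_of_apply_star_mul {x : A} (hx : φ (star x * x) = 0) : x = 0 := by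
  refine D.antipode.faithful D.left_inv D.ne_zero fun p => ?_
  have h := @InnerProductSpace.Core.inner_mul_inner_self_le ℂ A _ _ _
    (IsPositiveFunctional.preCore D.pos) (star p) x
  change ‖φ (star (star p) * x)‖ * ‖φ (star x * star p)‖ ≤
    _ * RCLike.re (φ (star x * x)) at h
  rw [hx, IsPositiveFunctional.apply_star_mul D.pos (star p) x, star_star, norm_star] at h
  simp only [map_zero, mul_zero] at h
  exact norm_eq_zero.1 (mul_self_eq_zero.1 (le_antisymm h (mul_self_nonneg _)))

/-- The inner product `φ (x* y)`. -/
abbrev core : InnerProductSpace.Core ℂ A where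
  __ := IsPositiveFunctional.preCore D.pos
  definite _ hx := D.eq_zero_of_apply_star_mul hx

theorem apply_star_mul_pos {x : A} (hx : x ≠ 0) : 0 < φ (star x * x) :=
  lt_of_le_of_ne (D.pos x) fun h => hx (D.eq_zero_of_apply_star_mul h.symm)

theorem apply_sliceLeft_star_mul_nonneg (X : A ⊗[ℂ] A) : 0 ≤ φ (sliceLeft φ (star X * X)) := by
  obtain ⟨s, rfl⟩ := TensorProduct.exists_finset X
  have h := tensor_inner_nonneg D.core s Prod.fst Prod.snd
  change 0 ≤ ∑ i ∈ s, ∑ j ∈ s, φ (star i.1 * j.1) * φ (star i.2 * j.2) at h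
  simpa [Finset.sum_mul_sum, Algebra.TensorProduct.tmul_mul_tmul] using h

/-- The modular element is positive. -/
theorem apply_star_mul_map_nonneg (b : A) : 0 ≤ φ (star b * L b) := by
  have := D.nontrivial
  obtain ⟨x, hx⟩ := exists_ne (0 : A)
  -- On this element φ⊗φ takes the value φ(x*x)φ(b*δb), where φ(x*x) > 0.
  have h : (oneTmul (star b)).left (H.T₁ ((star x * x) ⊗ₜ[ℂ] b)) =
      star (H.T₁ (x ⊗ₜ[ℂ] b)) * H.T₁ (x ⊗ₜ[ℂ] b) := by
    have h' : star (H.T₁ (x ⊗ₜ[ℂ] b)) = H.T₄ (star x ⊗ₜ[ℂ] star b) := by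
      rw [T₄_apply, TensorProduct.star_tmul, star_star, star_star]
    apply H.ofElem_injective
    rw [h', H.ofElem_left, ← MultiplierAlg.left_ofElem (H.T₄ _), H.ofElem_left, H.ofElem_T₁, H.ofElem_T₁,
      H.ofElem_T₄, _root_.map_mul]
    simp only [mul_assoc]
  have h₁ := D.apply_sliceLeft_star_mul_nonneg (H.T₁ (x ⊗ₜ[ℂ] b))
  rw [← h, sliceLeft_left_oneTmul, D.sliceLeft_T₁, mul_smul_comm, map_smul, smul_eq_mul] at h₁
  obtain ⟨hc, hc'⟩ := Complex.pos_iff.1 (D.apply_star_mul_pos hx)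
  obtain ⟨hr, hi⟩ := Complex.nonneg_iff.1 h₁
  rw [Complex.mul_re, ← hc', zero_mul, sub_zero] at hr
  rw [Complex.mul_im, ← hc', zero_mul, add_zero] at hi
  exact Complex.nonneg_iff.2 ⟨nonneg_of_mul_nonneg_right hr hc,
    ((mul_eq_zero.1 hi.symm).resolve_left hc.ne').symm⟩

theorem star_map_mul (x y : A) : star (L x) * y = star x * L y := by
  rw [← D.conjMap_mul]
  change star (L x) * y = star (L (star (star x))) * y
  rw [star_star]

/-- Formally (φ(δⁿ·δⁿ)⊗ι)Δ(a) = φ(δⁿaδⁿ)δ^(1-2n). Powers on both sides keep the coefficient strictly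
positive at a = xx* with x ≠ 0. -/
theorem sliceLeft_comp_pow_T₁ (e : A ≃ₗ[ℂ] A) (he : ∀ x, e x = L x) (n : ℕ) (a q : A) :
    sliceLeft (φ ∘ₗ (L ∘ₗ MultiplierAlg.conjMap L) ^ n) (H.T₁ (a ⊗ₜ[ℂ] q)) =
      φ (((L ∘ₗ MultiplierAlg.conjMap L) ^ n) a) •
        L (((e.symm.toLinearMap ∘ₗ e.symm.toLinearMap) ^ n) q) := by
  induction n generalizing a q with
  | zero => exact D.sliceLeft_T₁ a q
  | succ n ih =>
    obtain ⟨q, rfl⟩ := D.map_surjective q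
    apply D.map_injective
    have h₁ : TensorProduct.map L L ((MultiplierAlg.conjMap L).rTensor A (H.T₁ (a ⊗ₜ[ℂ] L q))) =
        H.T₁ (L (MultiplierAlg.conjMap L a) ⊗ₜ[ℂ] q) := by
      rw [D.T₁_map_tmul, D.T₁_conjMap_tmul]
    have h₂ := ih (L (MultiplierAlg.conjMap L a)) q
    rw [← h₁, sliceLeft_map, sliceLeft_rTensor] at h₂
    have hL (x : A) : L (e.symm x) = x := by rw [← he, LinearEquiv.apply_symm_apply]
    have hL' (x : A) : e.symm (L x) = x := by rw [← he, LinearEquiv.symm_apply_apply]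
    have hG : (e.symm.toLinearMap ∘ₗ e.symm.toLinearMap) (L q) = e.symm q := by simp [hL']
    have hC (n : ℕ) (x : A) : ((e.symm.toLinearMap ∘ₗ e.symm.toLinearMap) ^ n) (e.symm x) =
        e.symm (((e.symm.toLinearMap ∘ₗ e.symm.toLinearMap) ^ n) x) := by
      induction n generalizing x with
      | zero => rfl
      | succ n ih =>
        rw [pow_succ, Module.End.mul_apply, Module.End.mul_apply, ← ih]
        rfl
    rw [pow_succ, pow_succ, Module.End.mul_apply, Module.End.mul_apply, hG, hC, hL, map_smul]
    exact h₂

theorem map_conjMap_pow (n : ℕ) (x : A) :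
    ((L ∘ₗ MultiplierAlg.conjMap L) ^ n) (x * star x) = (L ^ n) x * star ((L ^ n) x) := by
  induction n generalizing x with
  | zero => rfl
  | succ n ih =>
    have h : (L ∘ₗ MultiplierAlg.conjMap L) (x * star x) = L x * star (L x) := by
      rw [LinearMap.comp_apply, D.conjMap_map_mul, D.map_mul]
      change _ * star (L (star (star x))) = _
      rw [star_star]
    rw [pow_succ, pow_succ, Module.End.mul_apply, Module.End.mul_apply, h, ih]

/-- Every element lies in a finite-dimensional subspace that is invariant under multiplication by
the modular element. -/
theorem exists_finiteDimensional_invariant (w : A) :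
    ∃ U : Submodule ℂ A, FiniteDimensional ℂ U ∧ w ∈ U ∧ ∀ x ∈ U, L x ∈ U := by
  have := D.nontrivial
  obtain ⟨x, hx⟩ := exists_ne (0 : A)
  let e : A ≃ₗ[ℂ] A := LinearEquiv.ofBijective L ⟨D.map_injective, D.map_surjective⟩
  have he (x : A) : e x = L x := rfl
  have hL (x : A) : L (e.symm x) = x := by rw [← he, LinearEquiv.apply_symm_apply]
  let G : A →ₗ[ℂ] A := e.symm.toLinearMap ∘ₗ e.symm.toLinearMap
  have hG (x : A) : L (L (G x)) = x := by simp [G, hL]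
  have hLG (x : A) : L (G x) = G (L x) := by
    apply e.symm.injective
    apply e.symm.injective
    simp [G, ← he]
  obtain ⟨W, hW, hWmem⟩ := exists_finiteDimensional_sliceLeft_mem
    (H.T₁ ((x * star x) ⊗ₜ[ℂ] w))
  -- The slice in W is δ^(1-2n)w times φ(δⁿx(δⁿx)*), which is nonzero by faithfulness and
  -- injectivity of δ.
  have hv (n : ℕ) : L ((G ^ n) w) ∈ W := by
    have h := hWmem (φ ∘ₗ (L ∘ₗ MultiplierAlg.conjMap L) ^ n)
    rw [D.sliceLeft_comp_pow_T₁ e he n] at h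
    refine (Submodule.smul_mem_iff _ ?_).1 h
    rw [D.map_conjMap_pow]
    have hLn : (L ^ n) x ≠ 0 := by
      rw [Module.End.pow_apply]
      intro h0
      refine hx (D.map_injective.iterate n ?_)
      rw [h0, ← Module.End.pow_apply, map_zero]
    have hpos := D.apply_star_mul_pos (x := star ((L ^ n) x)) (by simpa using hLn)
    rw [star_star] at hpos
    exact hpos.ne'
  let V : Submodule ℂ A := Submodule.span ℂ (Set.range fun n => L ((G ^ n) w))
  have hVW : V ≤ W := Submodule.span_le.2 (by rintro _ ⟨n, rfl⟩; exact hv n)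
  have hVfin : FiniteDimensional ℂ V := Submodule.finiteDimensional_of_le hVW
  have hGV : V.map G ≤ V := by
    rw [Submodule.map_span_le]
    rintro _ ⟨n, rfl⟩
    refine Submodule.subset_span ⟨n + 1, ?_⟩
    change L ((G ^ (n + 1)) w) = G (L ((G ^ n) w))
    rw [← hLG, pow_succ', Module.End.mul_apply]
  have hGinj : Function.Injective G := e.symm.injective.comp e.symm.injective
  -- In finite dimension the injective G = δ⁻² maps V onto V. So V is stable under δ², and V + δV
  -- under δ.
  have hGV' : V.map G = V := Submodule.eq_of_le_of_finrank_eq hGV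
    (Submodule.equivMapOfInjective G hGinj V).finrank_eq.symm
  refine ⟨V ⊔ V.map L, inferInstance, ?_, fun y hy => ?_⟩
  · refine Submodule.mem_sup_right ⟨L ((G ^ 1) w), Submodule.subset_span ⟨1, rfl⟩, ?_⟩
    rw [pow_one, hG]
  · obtain ⟨u, hu, _, ⟨v, hv, rfl⟩, rfl⟩ := Submodule.mem_sup.1 hy
    rw [map_add, add_comm]
    refine Submodule.add_mem_sup ?_ ⟨u, hu, rfl⟩
    rw [← hGV'] at hv
    obtain ⟨v, hv, rfl⟩ := hv
    rwa [hG]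

end ModularData
end


section

variable {A : Type*} [NonUnitalRing A] [StarRing A] [Module ℂ A]
    [IsScalarTower ℂ A A] [SMulCommClass ℂ A A] [StarModule ℂ A]
    {H : MultiplierHopfStarAlgebra A} {φ ε : A →ₗ[ℂ] ℂ} {S L : A →ₗ[ℂ] A}

/-! ### Eigenvectors of δ and positivity of φ∘S -/

namespace ModularData

variable (D : H.ModularData φ ε S L)

include D

theorem exists_nonneg_of_map_eq_smul {e : A} {μ : ℂ} (he : L e = μ • e) :
    ∃ r : ℝ, 0 ≤ r ∧ L e = (r : ℂ) • e := by
  by_cases h0 : e = 0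
  · exact ⟨0, le_rfl, by simp [h0]⟩
  have h := D.apply_star_mul_map_nonneg e
  rw [he, mul_smul_comm, map_smul, smul_eq_mul] at h
  obtain ⟨hc, hc'⟩ := Complex.pos_iff.1 (D.apply_star_mul_pos h0)
  obtain ⟨hr, hi⟩ := Complex.nonneg_iff.1 h
  rw [Complex.mul_re, ← hc', mul_zero, sub_zero] at hr
  rw [Complex.mul_im, ← hc', mul_zero, zero_add] at hi
  have hμ : μ = (μ.re : ℂ) :=
    Complex.ext rfl ((mul_eq_zero.1 hi.symm).resolve_right hc.ne')
  exact ⟨μ.re, nonneg_of_mul_nonneg_left hr hc, by rw [← hμ, he]⟩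

/-- Every element is a sum of eigenvectors of the modular element, with nonnegative eigenvalues. -/
theorem exists_sum_eigenvectors (w : A) : ∃ (n : ℕ) (e : Fin n → A) (r : Fin n → ℝ),
    w = ∑ i, e i ∧ ∀ i, 0 ≤ r i ∧ L (e i) = (r i : ℂ) • e i := by
  obtain ⟨U, hU, hw, hLU⟩ := D.exists_finiteDimensional_invariant w
  let c : InnerProductSpace.Core ℂ U :=
    { inner x y := φ (star (x : A) * y)
      conj_inner_symm x y := D.core.conj_inner_symm x y
      re_inner_nonneg x := D.core.re_inner_nonneg x
      add_left x y z := D.core.add_left x y z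
      smul_left x y r := D.core.smul_left x y r
      definite x hx := Subtype.ext (D.core.definite x hx) }
  have h := mem_span_eigenvectors c (L.restrict hLU)
    (fun x y => congrArg φ (D.star_map_mul x y)) ⟨w, hw⟩
  obtain ⟨n, k, e, hsum⟩ := Submodule.mem_span_set'.1 h
  have he (i : Fin n) : ∃ r : ℝ, 0 ≤ r ∧
      L (k i • (e i : U) : U) = (r : ℂ) • ((k i • (e i : U) : U) : A) := by
    obtain ⟨μ, hμ⟩ := (e i).2
    have hμ' : L ((e i : U) : A) = μ • ((e i : U) : A) := congrArg Subtype.val hμ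
    refine D.exists_nonneg_of_map_eq_smul (μ := μ) ?_
    rw [Submodule.coe_smul, map_smul, hμ', smul_comm]
  choose r hr hr' using he
  refine ⟨n, fun i => (k i • (e i : U) : U), r, ?_, fun i => ⟨hr i, hr' i⟩⟩
  have := congrArg Subtype.val hsum
  simpa using this.symm

theorem conjMap_star_of_eigenvector {e : A} {r : ℝ} (he : L e = (r : ℂ) • e) :
    MultiplierAlg.conjMap L (star e) = (r : ℂ) • star e := by
  change star (L (star (star e))) = _
  rw [star_star, he, star_smul]
  simp

/-- The functional `φ` commutes with the modular element. -/
theorem apply_map_eq (x : A) : φ (L x) = φ (MultiplierAlg.conjMap L x) := by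
  have := D.nontrivial
  obtain ⟨w, hw⟩ := exists_ne (0 : A)
  obtain ⟨n, e, r, hsum, he⟩ := D.exists_sum_eigenvectors w
  obtain ⟨i, hi⟩ : ∃ i, e i ≠ 0 := by
    by_contra! h
    exact hw (by simp [hsum, h])
  obtain ⟨c, hc⟩ := D.exists_apply_map_eq
  have hr : (r i : ℂ) ≠ 0 := fun h => hi (D.map_injective (by rw [(he i).2, h]; simp))
  -- At this element the relation reads rφ(ee*) = c·rφ(ee*) with both factors nonzero.
  have h := hc (e i * star (e i))
  have hpos := D.apply_star_mul_pos (x := star (e i)) (by simpa using hi)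
  rw [star_star] at hpos
  rw [D.map_mul, D.conjMap_map_mul, (he i).2, D.conjMap_star_of_eigenvector (he i).2,
    smul_mul_assoc, mul_smul_comm, map_smul, smul_eq_mul] at h
  have hc1 : c = 1 := (mul_right_cancel₀ (mul_ne_zero hr hpos.ne') (by rw [one_mul, ← h])).symm
  rw [hc, hc1, one_mul]

theorem antipode_pos : IsPositiveFunctional (φ ∘ₗ S) := fun b => by
  obtain ⟨n, e, r, hsum, he⟩ := D.exists_sum_eigenvectors (star b)
  have hb : b = ∑ i, star (e i) := by rw [← star_star b, hsum, star_sum]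
  -- From φ(δ·) = φ(·δ), either φ(e_i e_j*) = 0 or r_i = r_j, so r_j may be replaced by √r_i √r_j.
  have key (i j : Fin n) : (r j : ℂ) * φ (e i * star (e j)) =
      ((√(r i) : ℝ) : ℂ) * ((√(r j) : ℝ) : ℂ) * φ (e i * star (e j)) := by
    have h := D.apply_map_eq (e i * star (e j))
    rw [D.map_mul, D.conjMap_map_mul, (he i).2, D.conjMap_star_of_eigenvector (he j).2,
      smul_mul_assoc, mul_smul_comm, map_smul, map_smul, smul_eq_mul, smul_eq_mul] at h
    by_cases h0 : φ (e i * star (e j)) = 0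
    · simp [h0]
    have hij : r i = r j := Complex.ofReal_injective (mul_right_cancel₀ h0 h)
    rw [hij, ← Complex.ofReal_mul, Real.mul_self_sqrt (he j).1]
  -- The sum plays the role of δ^(1/2)b*.
  have hy := D.pos (star (∑ i, ((√(r i) : ℝ) : ℂ) • e i))
  rw [LinearMap.comp_apply, D.apply_antipode, D.conjMap_map_mul, hsum, hb]
  convert hy using 1
  simp only [map_sum, star_sum, star_smul, star_star, Finset.sum_mul_sum,
    D.conjMap_star_of_eigenvector (he _).2, smul_mul_assoc, mul_smul_comm, map_smul, smul_eq_mul,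
    key, RCLike.star_def, Complex.conj_ofReal]
  refine Finset.sum_congr rfl fun i _ => Finset.sum_congr rfl fun j _ => ?_
  ring

end ModularData

end

end MultiplierHopfStarAlgebra

end

theorem mainTheorem3 {A : Type*} [NonUnitalRing A] [StarRing A] [Module ℂ A]
    [IsScalarTower ℂ A A] [SMulCommClass ℂ A A] [StarModule ℂ A]
    (H : MultiplierHopfStarAlgebra A) (φ : A →ₗ[ℂ] ℂ)
    (hφ : H.IsLeftIntegral φ) (hpos : IsPositiveFunctional φ) :
    (∃! S : A →ₗ[ℂ] A, H.IsAntipode S) ∧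
      ∀ S : A →ₗ[ℂ] A, H.IsAntipode S →
        H.IsRightIntegral (φ ∘ₗ S) ∧ IsPositiveFunctional (φ ∘ₗ S) := by
  have hφ' := hφ.isLeftInvariant
  refine ⟨?_, fun S hS => ⟨(hS.isRightInvariant hφ' hφ.1).isRightIntegral
    (hS.comp_ne_zero hφ' hφ.1), ?_⟩⟩
  · obtain ⟨S, hS⟩ := hφ'.exists_isAntipode hφ.1
    exact ⟨S, hS, fun S' hS' => hS'.unique hS⟩
  · obtain ⟨ε, L, D⟩ := hS.exists_modularData hφ' hφ.1 hpos
    exact D.antipode_pos
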